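/- Let $d\ge 1$, $Q_d=(-\pi,\pi)^d\subset\mathbb R^d$ and $\omega(x)=\sum_{j=1}^d\sin^2(x_j/2)$. Let $\psi\in C^\infty(\overline{Q_d};\mathbb C)$ be such that $\psi$ and all its derivatives are $2\pi$-periodic in each variable (that is, they take equal values at opposite points of the faces $x_j=-\pi$ and $x_j=\pi$ of $\overline{Q_d}$), and assume that $\int_{Q_d}\psi\,dx=0$. Let $k\le 0$ and $m\ge 0$ be integers. **Constants.** For functions $A_1,A_2$ of $(k,d)$ put $$S[A_1,A_2](k,d)=\sum_{j=0}^{-k}d^{\,j}A_1(k+j,d)\prod_{i=0}^{j-1}A_2(k+i,d)+d^{-k}\prod_{i=0}^{-k}A_2(k+i,d).$$ Let $H(k,d)=S[A_1,A_2](k,d)^{-1}$ with $$A_1(k,d)=\frac{16}{(d+2k-2)^2},\qquad A_2(k,d)=\frac{3d+2k-2}{d(d+2k-2)},$$ and let $HR(k,d)=S[B_1,B_2](k,d)^{-1}$ with $$B_1(k,d)=\frac{16}{(d-2k)^2},\qquad B_2(k,d)=\frac{3d-2k+4}{d(d-2k)}.$$ For real $\alpha\le 0$ let $\beta=\beta(\alpha,d)=\tfrac18\bigl(-4+8\alpha+\sqrt2\sqrt{d^2-4d+16\alpha^2-16\alpha+8}\bigr)$,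 $$C_1(\alpha,d)=\frac{2\beta(d-2\beta+2\alpha-1)}{d},\qquad C_2(\alpha,d)=\frac{\beta(d+4\beta-4\alpha)(d+2\alpha-2)(2\beta-2\alpha+1)}{2d},$$ and let $$R(k,d)=\frac{(d-2k)^2(d+2k-4)^2}{256\Bigl(1+HR(k,d)^{-1}\bigl(d\,C_1(k/2,d)+d\,C_2(k/2,d)\,H(k,d)^{-1}\bigr)\Bigr)}.$$ **Theorem 3.11.** 1. If $d>-2k+4m$, then both integrals below are finite and $$\prod_{i=0}^{m-1}R(k-2i,d)\int_{Q_d}|\psi(x)|^2\,\omega(x)^{k-2m}\,dx\le\int_{Q_d}|\Delta^m\psi(x)|^2\,\omega(x)^k\,dx.$$ 2. If $d>-2k+4m+2$, then both integrals below are finite and $$H(k,d)\prod_{i=0}^{m-1}R(k-2i-1,d)\int_{Q_d}|\psi(x)|^2\,\omega(x)^{k-(2m+1)}\,dx\le\int_{Q_d}|\nabla(\Delta^m\psi)(x)|^2\,\omega(x)^k\,dx.$$ Here $|\nabla\varphi|^2=\sum_{j=1}^d|\partial_{x_j}\varphi|^2$, and empty products equal $1$. -/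

import Mathlib

open Real MeasureTheory
open scoped ContDiff

noncomputable section

namespace TorusHardy

/-- The open cube `Q_d = (-π, π)^d` in `ℝ^d`. -/
def cube (d : ℕ) : Set (EuclideanSpace ℝ (Fin d)) :=
  {x | ∀ j, x j ∈ Set.Ioo (-π) π}

/-- The closed cube `[-π, π]^d`, the closure of `Q_d`. -/
def closedCube (d : ℕ) : Set (EuclideanSpace ℝ (Fin d)) :=
  {x | ∀ j, x j ∈ Set.Icc (-π) π}

/-- `ψ ∈ C^∞` on the closed cube, and all derivatives of `ψ`, of every order `n ≥ 0`, are
`2π`-periodic in each variable: their values at a point of the face `x_j = -π` and at the opposite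
point of the face `x_j = π` coincide. Only the values of `ψ` on the closed cube matter. -/
structure SmoothPeriodic {d : ℕ} (ψ : EuclideanSpace ℝ (Fin d) → ℂ) : Prop where
  contDiffOn : ContDiffOn ℝ ∞ ψ (closedCube d)
  periodic : ∀ (n : ℕ) (j : Fin d), ∀ x ∈ closedCube d, x j = -π →
    iteratedFDerivWithin ℝ n ψ (closedCube d) (x + EuclideanSpace.single j (2 * π)) =
      iteratedFDerivWithin ℝ n ψ (closedCube d) x

/-- The weight `ω(x) = ∑_j sin²(x_j / 2)`. -/
def omega {d : ℕ} (x : EuclideanSpace ℝ (Fin d)) : ℝ :=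
  ∑ j, sin (x j / 2) ^ 2

/-- The iterated Laplacian `Δ^m φ` of a function on the closed cube (with one-sided derivatives on
the boundary). -/
def iterLaplacian {d : ℕ} (m : ℕ) (φ : EuclideanSpace ℝ (Fin d) → ℂ) :
    EuclideanSpace ℝ (Fin d) → ℂ :=
  (fun f => InnerProductSpace.laplacianWithin f (closedCube d))^[m] φ

/-- `|∇φ(x)|² = ∑_j |∂_{x_j} φ(x)|²` for a complex-valued function on the closed cube. -/
def gradSq {d : ℕ} (φ : EuclideanSpace ℝ (Fin d) → ℂ) (x : EuclideanSpace ℝ (Fin d)) : ℝ :=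
  ∑ j, ‖fderivWithin ℝ φ (closedCube d) x (EuclideanSpace.single j 1)‖ ^ 2

/-- First auxiliary constant of the weighted Hardy inequality. -/
def hardyC1 (k : ℤ) (d : ℕ) : ℝ := 16 / ((d : ℝ) + 2 * k - 2) ^ 2

/-- Second auxiliary constant of the weighted Hardy inequality. -/
def hardyC2 (k : ℤ) (d : ℕ) : ℝ :=
  (3 * (d : ℝ) + 2 * k - 2) / (d * ((d : ℝ) + 2 * k - 2))

/-- First auxiliary constant of the weighted Hardy-Rellich inequality. -/
def hardyRellichC1 (k : ℤ) (d : ℕ) : ℝ := 16 / ((d : ℝ) - 2 * k) ^ 2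

/-- Second auxiliary constant of the weighted Hardy-Rellich inequality. -/
def hardyRellichC2 (k : ℤ) (d : ℕ) : ℝ :=
  (3 * (d : ℝ) - 2 * k + 4) / (d * ((d : ℝ) - 2 * k))

/-- For `k ≤ 0`, the sum
`∑_{j=0}^{-k} d^j C₁(k+j, d) ∏_{i=0}^{j-1} C₂(k+i, d) + d^{-k} ∏_{i=0}^{-k} C₂(k+i, d)`. -/
def constSum (C₁ C₂ : ℤ → ℕ → ℝ) (k : ℤ) (d : ℕ) : ℝ :=
  (∑ j ∈ Finset.range ((-k).toNat + 1),
      (d : ℝ) ^ j * C₁ (k + j) d * ∏ i ∈ Finset.range j, C₂ (k + i) d) +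
    (d : ℝ) ^ (-k).toNat * ∏ i ∈ Finset.range ((-k).toNat + 1), C₂ (k + i) d

/-- The constant `H(k, d)` of the weighted Hardy inequality. -/
def H (k : ℤ) (d : ℕ) : ℝ := (constSum hardyC1 hardyC2 k d)⁻¹

/-- The constant `HR(k, d)` of the weighted Hardy-Rellich inequality. -/
def HR (k : ℤ) (d : ℕ) : ℝ := (constSum hardyRellichC1 hardyRellichC2 k d)⁻¹

/-- The parameter `β(α, d)` entering the constant of the weighted Rellich inequality. -/
def rellichBeta (α : ℝ) (d : ℕ) : ℝ :=
  1 / 8 * (-4 + 8 * α + √2 * √((d : ℝ) ^ 2 - 4 * d + 16 * α ^ 2 - 16 * α + 8))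

/-- First auxiliary constant of the weighted Rellich inequality. -/
def rellichC1 (α : ℝ) (d : ℕ) : ℝ :=
  2 * rellichBeta α d * (d - 2 * rellichBeta α d + 2 * α - 1) / d

/-- Second auxiliary constant of the weighted Rellich inequality. -/
def rellichC2 (α : ℝ) (d : ℕ) : ℝ :=
  rellichBeta α d * (d + 4 * rellichBeta α d - 4 * α) * (d + 2 * α - 2) *
    (2 * rellichBeta α d - 2 * α + 1) / (2 * d)

/-- The constant `R(k, d)` of the weighted Rellich inequality. -/
def R (k : ℤ) (d : ℕ) : ℝ :=
  ((d : ℝ) - 2 * k) ^ 2 * ((d : ℝ) + 2 * k - 4) ^ 2 /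
    (256 * (1 + (HR k d)⁻¹ *
      (d * rellichC1 ((k : ℝ) / 2) d + d * rellichC2 ((k : ℝ) / 2) d * (H k d)⁻¹)))

end TorusHardy

end

/-! The weight `ω` plays the role of `|x|²/4`: `∇ω = (sin x_j / 2)_j`, `Δω = d/2 - ω`, and `|∇ω|² ≤
ω - ω²/d` (`sum_sin_sq_le`). The corrections `-ω` and `-ω²/d`, absent in Euclidean space, produce
terms with one more power of `ω`. These are removed by lowering the exponent back with `ω ≤ d` and,
at exponent zero, by the Poincaré inequality, which is where the vanishing mean enters.

Hardy: integrating `|f|²` by parts against `ω^(k-1) ∇ω` and applying Young's inequality gives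
`hardy_step`, a bound by the gradient at weight `ω^k` plus a remainder `|f|² ω^k`. The remainder is
the left side of the same inequality at `k + 1`. Iterating up to `k = 0` and ending with Poincaré
yields exactly the recursion solved by `constSum` (`weighted_hardy`).

Rellich: `∫ |∇f|² ω^(k-1)` plus `∫ Re(f̄ Δf) ω^(k-1)` is a multiple of the radial term. Bounding the
gradient below by `hardy_step`, the radial term above by integration by parts, and the pairing with
`Δf` by Young gives `rellich_step`: the leading constant is `rellichM ^ 2`, with a lower order
remainder in `|f|² ω^(k-1)`. That remainder is bounded by the Laplacian through an induction on `k`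
which feeds `rellich_step` into itself (`weightedIntegral_lower_order_le`).

The Hardy-Rellich inequality itself is not needed. `HR` enters only as a number, through its
recursion and the bound `three_le_mul_hardyRellich_constSum`. Purely algebraic estimates
(`rellich_const_step`, `le_R_denom`) show that the constant obtained is at least `R`.

Powers of the Laplacian preserve smoothness, periodicity and zero mean, so the Rellich inequality
can be iterated, each application lowering the exponent by two. The gradient statement adds one
Hardy step in front. -/

namespace TorusHardy

/-! ### The cube and pointwise properties of the weight. -/

section

variable {d : ℕ} {F : Type*} [NormedAddCommGroup F] [NormedSpace ℝ F]

/-- The partial derivative `∂_j f` relative to the closed cube. -/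
noncomputable def pd (j : Fin d) (f : EuclideanSpace ℝ (Fin d) → F)
    (x : EuclideanSpace ℝ (Fin d)) : F :=
  fderivWithin ℝ f (closedCube d) x (EuclideanSpace.single j 1)

lemma cube_subset_closedCube : cube d ⊆ closedCube d :=
  fun _ hx j => Set.Ioo_subset_Icc_self (hx j)

lemma isOpen_cube : IsOpen (cube d) := by
  have : cube d = ⋂ j, (fun x : EuclideanSpace ℝ (Fin d) => x j) ⁻¹' Set.Ioo (-π) π := by
    ext x; simp [cube]
  rw [this]
  exact isOpen_iInter_of_finite fun j => isOpen_Ioo.preimage (by fun_prop)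

lemma isClosed_closedCube : IsClosed (closedCube d) := by
  have : closedCube d = ⋂ j, (fun x : EuclideanSpace ℝ (Fin d) => x j) ⁻¹' Set.Icc (-π) π := by
    ext x; simp [closedCube]
  rw [this]
  exact isClosed_iInter fun j => isClosed_Icc.preimage (by fun_prop)

lemma measurableSet_cube : MeasurableSet (cube d) := isOpen_cube.measurableSet

lemma closedCube_eq_preimage :
    closedCube d = (WithLp.ofLp : EuclideanSpace ℝ (Fin d) → Fin d → ℝ) ⁻¹'
      Set.Icc (fun _ => -π) (fun _ => π) := by
  ext x
  simp [closedCube, Pi.le_def, forall_and]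

lemma isCompact_closedCube : IsCompact (closedCube d) := by
  have h : IsCompact (Set.Icc (fun _ : Fin d => -π) (fun _ => π)) := isCompact_Icc
  rw [closedCube_eq_preimage]
  exact (EuclideanSpace.equiv (Fin d) ℝ).toHomeomorph.isCompact_preimage.2 h

lemma convex_closedCube : Convex ℝ (closedCube d) := by
  intro x hx y hy a b ha hb hab j
  simpa using convex_Icc (-π) π (hx j) (hy j) ha hb hab

/-- A convex set with nonempty interior determines derivatives up to its boundary, so one-sided
derivatives on the faces can be handled by the usual calculus rules. -/
lemma uniqueDiffOn_closedCube : UniqueDiffOn ℝ (closedCube d) := by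
  refine uniqueDiffOn_convex convex_closedCube ⟨0, ?_⟩
  refine interior_mono cube_subset_closedCube ?_
  rw [isOpen_cube.interior_eq]
  intro j
  simp [Real.pi_pos]

lemma closedCube_mem_nhds {x : EuclideanSpace ℝ (Fin d)} (hx : x ∈ cube d) :
    closedCube d ∈ nhds x :=
  Filter.mem_of_superset (isOpen_cube.mem_nhds hx) cube_subset_closedCube

lemma omega_nonneg (x : EuclideanSpace ℝ (Fin d)) : 0 ≤ omega x :=
  Finset.sum_nonneg fun _ _ => sq_nonneg _

lemma omega_le (x : EuclideanSpace ℝ (Fin d)) : omega x ≤ d := by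
  calc omega x ≤ ∑ _j : Fin d, (1 : ℝ) := Finset.sum_le_sum fun j _ => sin_sq_le_one _
    _ = d := by simp

lemma contDiff_omega {n : WithTop ℕ∞} : ContDiff ℝ n (omega (d := d)) := by
  unfold omega
  fun_prop

lemma continuous_omega : Continuous (omega (d := d)) := contDiff_omega (n := 0).continuous

lemma abs_le_pi_mul_abs_sin {t : ℝ} (ht : t ∈ Set.Icc (-π) π) : |t| ≤ π * |sin (t / 2)| := by
  have hp := Real.pi_pos
  have key : ∀ s : ℝ, 0 ≤ s → s ≤ π → s ≤ π * sin (s / 2) := by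
    intro s h0 h1
    have := Real.mul_le_sin (x := s / 2) (by linarith) (by linarith)
    have h2 : 2 / π * (s / 2) = s / π := by ring
    rw [h2, div_le_iff₀ hp] at this
    linarith
  have h := key |t| (abs_nonneg t) (abs_le.2 ⟨ht.1, ht.2⟩)
  refine h.trans (mul_le_mul_of_nonneg_left ?_ hp.le)
  rcases abs_cases t with ⟨h, _⟩ | ⟨h, _⟩ <;> rw [h]
  · exact le_abs_self _
  · rw [neg_div, sin_neg]; exact neg_le_abs _

lemma omega_pos {x : EuclideanSpace ℝ (Fin d)} (hx : x ∈ closedCube d) (h0 : x ≠ 0) :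
    0 < omega x := by
  obtain ⟨j, hj⟩ : ∃ j, x j ≠ 0 := by
    by_contra! h
    exact h0 (by ext j; simpa using h j)
  refine Finset.sum_pos' (fun _ _ => sq_nonneg _) ⟨j, Finset.mem_univ _, ?_⟩
  have h1 := abs_le_pi_mul_abs_sin (hx j)
  have h2 : sin (x j / 2) ≠ 0 := by
    intro h
    rw [h] at h1
    simp only [abs_zero, mul_zero] at h1
    exact hj (abs_nonpos_iff.1 h1)
  positivity

/-- The origin is the only zero of `ω` in the cube and is a null set when `d ≠ 0`. Laws such as
`ω^(p+1) = ω^p ω`, which may fail at `ω = 0`, thus hold almost everywhere. -/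
lemma ae_cube [NeZero d] : ∀ᵐ x ∂(volume.restrict (cube d)), x ∈ cube d ∧ 0 < omega x := by
  have : Nontrivial (EuclideanSpace ℝ (Fin d)) := by
    have : Nonempty (Fin d) := ⟨0⟩
    infer_instance
  have h0 : ∀ᵐ x ∂(volume.restrict (cube d)), x ≠ 0 :=
    ae_restrict_of_ae (by simp [ae_iff])
  filter_upwards [h0, ae_restrict_mem measurableSet_cube] with x hx hc
  exact ⟨hc, omega_pos (cube_subset_closedCube hc) hx⟩

/-- The derivative of the weight: `∇ω = (sin(x_j) / 2)_j`. -/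
lemma hasFDerivAt_omega (x : EuclideanSpace ℝ (Fin d)) :
    HasFDerivAt (omega (d := d))
      (∑ j, (sin (x j) / 2) • (EuclideanSpace.proj j : EuclideanSpace ℝ (Fin d) →L[ℝ] ℝ)) x := by
  unfold omega
  refine HasFDerivAt.fun_sum fun j _ => ?_
  have h1 : HasDerivAt (fun t : ℝ => sin (t / 2) ^ 2) (sin (x j) / 2) (x j) := by
    have := ((hasDerivAt_id (x j)).div_const 2).sin.pow 2
    refine this.congr_deriv ?_
    have h2 : sin (x j) = 2 * sin (x j / 2) * cos (x j / 2) := by rw [← sin_two_mul]; ring_nf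
    rw [h2]; simp; ring
  exact h1.comp_hasFDerivAt x (EuclideanSpace.proj j : EuclideanSpace ℝ (Fin d) →L[ℝ] ℝ).hasFDerivAt

lemma pd_sin (j : Fin d) {x : EuclideanSpace ℝ (Fin d)} (hx : x ∈ closedCube d) :
    pd j (fun y => sin (y j) / 2) x = 1 / 2 - sin (x j / 2) ^ 2 := by
  unfold pd
  have h1 : HasDerivAt (fun t : ℝ => sin t / 2) (1 / 2 - sin (x j / 2) ^ 2) (x j) := by
    have := (Real.hasDerivAt_sin (x j)).div_const 2
    refine this.congr_deriv ?_
    have h2 : cos (x j) = 1 - 2 * sin (x j / 2) ^ 2 := by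
      have h4 := Real.cos_two_mul (x j / 2)
      rw [mul_div_cancel₀ (x j) two_ne_zero] at h4
      have h5 := sin_sq_add_cos_sq (x j / 2)
      linarith
    rw [h2]; ring
  have h3 := h1.comp_hasFDerivAt x
    (EuclideanSpace.proj j : EuclideanSpace ℝ (Fin d) →L[ℝ] ℝ).hasFDerivAt
  have h4 : HasFDerivAt (fun y : EuclideanSpace ℝ (Fin d) => sin (y j) / 2)
      ((1 / 2 - sin (x j / 2) ^ 2) •
        (EuclideanSpace.proj j : EuclideanSpace ℝ (Fin d) →L[ℝ] ℝ)) x := h3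
  rw [h4.hasFDerivWithinAt.fderivWithin (uniqueDiffOn_closedCube x hx)]
  simp

/-- With `s_j = sin²(x_j/2)` one has `(sin x_j / 2)² = s_j - s_j²`, and Cauchy-Schwarz gives `(∑
s_j)² ≤ d ∑ s_j²`. This is the bound on `|∇ω|²` behind all the inequalities below. -/
lemma sum_sin_sq_le [NeZero d] (x : EuclideanSpace ℝ (Fin d)) :
    ∑ j, (sin (x j) / 2) ^ 2 ≤ omega x - omega x ^ 2 / d := by
  have h1 : ∀ j, (sin (x j) / 2) ^ 2 = sin (x j / 2) ^ 2 - (sin (x j / 2) ^ 2) ^ 2 := by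
    intro j
    have h2 : sin (x j) = 2 * sin (x j / 2) * cos (x j / 2) := by rw [← sin_two_mul]; ring_nf
    rw [h2]
    have := sin_sq_add_cos_sq (x j / 2)
    have h3 : cos (x j / 2) ^ 2 = 1 - sin (x j / 2) ^ 2 := by linarith
    calc _ = sin (x j / 2) ^ 2 * cos (x j / 2) ^ 2 := by ring
      _ = _ := by rw [h3]; ring
  simp_rw [h1]
  rw [Finset.sum_sub_distrib]
  have h4 := sq_sum_le_card_mul_sum_sq (s := (Finset.univ : Finset (Fin d)))
    (f := fun j => sin (x j / 2) ^ 2)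
  have hd : (0 : ℝ) < d := by exact_mod_cast Nat.pos_of_ne_zero (NeZero.ne d)
  have h5 : omega x ^ 2 / d ≤ ∑ j, (sin (x j / 2) ^ 2) ^ 2 := by
    rw [div_le_iff₀ hd]
    simpa [omega, mul_comm] using h4
  have : omega x = ∑ j, sin (x j / 2) ^ 2 := rfl
  linarith

lemma sum_half_sub (x : EuclideanSpace ℝ (Fin d)) :
    ∑ j, (1 / 2 - sin (x j / 2) ^ 2) = d / 2 - omega x := by
  simp [Finset.sum_sub_distrib, omega, div_eq_mul_inv]

end

/-! ### Integrability of powers of the weight. -/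

section

variable {d : ℕ} {F : Type*} [NormedAddCommGroup F]

lemma cube_eq_preimage :
    cube d = (WithLp.ofLp : EuclideanSpace ℝ (Fin d) → Fin d → ℝ) ⁻¹'
      (Set.univ.pi fun _ => Set.Ioo (-π) π) := by
  ext x
  simp [cube]

lemma integrableOn_cube_iff (f : (Fin d → ℝ) → F) :
    IntegrableOn (fun x : EuclideanSpace ℝ (Fin d) => f x.ofLp) (cube d) ↔
      IntegrableOn f (Set.univ.pi fun _ => Set.Ioo (-π) π) := by
  rw [cube_eq_preimage]
  exact (EuclideanSpace.volume_preserving_symm_measurableEquiv_toLp (Fin d)).integrableOn_comp_preimage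
    (MeasurableEquiv.measurableEmbedding _)

lemma setIntegral_cube [NormedSpace ℝ F] (f : (Fin d → ℝ) → F) :
    ∫ x in cube d, f x.ofLp = ∫ y in Set.univ.pi fun _ => Set.Ioo (-π) π, f y := by
  rw [cube_eq_preimage]
  exact (EuclideanSpace.volume_preserving_symm_measurableEquiv_toLp (Fin d)).setIntegral_preimage_emb
    (MeasurableEquiv.measurableEmbedding _) _ _

lemma integrableOn_abs_rpow {r : ℝ} (hr : -1 < r) :
    IntegrableOn (fun t : ℝ => (|t| / π) ^ r) (Set.Ioo (-π) π) := by
  have hp := Real.pi_pos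
  have h1 : IntegrableOn (fun t : ℝ => (|t| / π) ^ r) (Set.Ioc 0 π) := by
    have h := (intervalIntegrable_iff_integrableOn_Ioc_of_le hp.le).1
      (intervalIntegral.intervalIntegrable_rpow' (a := 0) (b := π) hr)
    refine IntegrableOn.congr_fun (h.div_const (π ^ r)) (fun t ht => ?_) measurableSet_Ioc
    rw [abs_of_pos ht.1, Real.div_rpow ht.1.le hp.le]
  have h2 : IntegrableOn (fun t : ℝ => (|t| / π) ^ r) (Set.Ico (-π) 0) := by
    have := (h1.mono_set Set.Ioo_subset_Ioc_self).comp_neg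
    simp only [abs_neg, Set.neg_Ioo, neg_zero] at this
    rwa [integrableOn_Ico_iff_integrableOn_Ioo]
  have h3 : IntegrableOn (fun t : ℝ => (|t| / π) ^ r) (Set.Icc 0 π) := by
    rwa [integrableOn_Icc_iff_integrableOn_Ioc]
  refine (h2.union h3).mono_set fun t ht => ?_
  rcases lt_or_ge t 0 with h | h
  · exact Or.inl ⟨ht.1.le, h⟩
  · exact Or.inr ⟨h, ht.2.le⟩

/-- Arithmetic-geometric mean bound of the weight from below. -/
lemma prod_rpow_le_omega [NeZero d] {x : EuclideanSpace ℝ (Fin d)} (hx : x ∈ closedCube d) :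
    ∏ j, (|x j| / π) ^ (2 / d : ℝ) ≤ omega x := by
  have hd : (0 : ℝ) < d := by exact_mod_cast Nat.pos_of_ne_zero (NeZero.ne d)
  have hd1 : (1 : ℝ) ≤ d := by exact_mod_cast Nat.one_le_iff_ne_zero.2 (NeZero.ne d)
  have h1 := Real.geom_mean_le_arith_mean_weighted (Finset.univ : Finset (Fin d))
    (fun _ => 1 / (d : ℝ)) (fun j => sin (x j / 2) ^ 2) (fun _ _ => by positivity)
    (by simp [hd.ne']) (fun _ _ => sq_nonneg _)
  refine le_trans (Finset.prod_le_prod (fun _ _ => by positivity) fun j _ => ?_) (h1.trans ?_)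
  · have h2 := abs_le_pi_mul_abs_sin (hx j)
    have h3 : |x j| / π ≤ |sin (x j / 2)| := by
      rw [div_le_iff₀ Real.pi_pos]; linarith
    have h4 : (0 : ℝ) ≤ |x j| / π := by positivity
    calc (|x j| / π) ^ (2 / d : ℝ) = ((|x j| / π) ^ 2) ^ (1 / d : ℝ) := by
          rw [← Real.rpow_natCast, ← Real.rpow_mul h4]
          congr 1; push_cast; ring
      _ ≤ _ := by
          refine Real.rpow_le_rpow (by positivity) ?_ (by positivity)
          rw [← sq_abs (sin _)]
          gcongr
  -- The factor `1/d` of the arithmetic mean is discarded; only integrability depends on this bound.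
  · refine Finset.sum_le_sum fun j _ => ?_
    refine mul_le_of_le_one_left (sq_nonneg _) ?_
    rw [div_le_one hd]; exact hd1

lemma measurable_omega_zpow (p : ℤ) :
    Measurable fun x : EuclideanSpace ℝ (Fin d) => omega x ^ p :=
  continuous_omega.measurable.pow_const p

/-- For `p < 0` the arithmetic-geometric mean bound dominates `ω^p` by a product of one-variable
functions `(|x_j|/π)^(2p/d)`. The one-dimensional condition `2p/d > -1` is exactly `d + 2p > 0`, and
polar coordinates are avoided. -/
lemma integrableOn_omega_zpow [NeZero d] {p : ℤ} (h : 0 < (d : ℤ) + 2 * p) :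
    IntegrableOn (fun x : EuclideanSpace ℝ (Fin d) => omega x ^ p) (cube d) := by
  have hd : (0 : ℝ) < d := by exact_mod_cast Nat.pos_of_ne_zero (NeZero.ne d)
  rcases le_or_gt 0 p with hp | hp
  · lift p to ℕ using hp
    simp only [zpow_natCast]
    exact ((continuous_omega.pow p).continuousOn.integrableOn_compact
      isCompact_closedCube).mono_set cube_subset_closedCube
  have hr : -1 < (2 / d : ℝ) * p := by
    have : (0 : ℝ) < d + 2 * p := by exact_mod_cast h
    rw [div_mul_eq_mul_div, lt_div_iff₀ hd]; linarith
  have hg : IntegrableOn (fun x : EuclideanSpace ℝ (Fin d) =>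
      ∏ j, (|x j| / π) ^ ((2 / d : ℝ) * p)) (cube d) := by
    refine (integrableOn_cube_iff (fun y : Fin d → ℝ => ∏ j, (|y j| / π) ^ ((2 / d : ℝ) * p))).2 ?_
    unfold IntegrableOn
    rw [volume_pi, Measure.restrict_pi_pi]
    exact Integrable.fintype_prod (f := fun _ t => (|t| / π) ^ ((2 / d : ℝ) * p))
      fun _ => integrableOn_abs_rpow hr
  refine Integrable.mono' hg (measurable_omega_zpow p).aestronglyMeasurable ?_
  have hne : ∀ᵐ x : EuclideanSpace ℝ (Fin d), ∀ j, x j ≠ 0 := by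
    have h1 : ∀ᵐ y : Fin d → ℝ, ∀ j, y j ≠ 0 :=
      ae_all_iff.2 fun j => (Measure.ae_eval_ne (μ := fun _ : Fin d => (volume : Measure ℝ)) j 0)
    exact (EuclideanSpace.volume_preserving_symm_measurableEquiv_toLp
      (Fin d)).quasiMeasurePreserving.ae h1
  filter_upwards [ae_restrict_of_ae hne, ae_restrict_mem measurableSet_cube] with x hx hc
  have h2 : ∀ j, 0 < |x j| / π := fun j => div_pos (abs_pos.2 (hx j)) Real.pi_pos
  have h3 : 0 < ∏ j, (|x j| / π) ^ (2 / d : ℝ) :=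
    Finset.prod_pos fun j _ => Real.rpow_pos_of_pos (h2 j) _
  have h4 := prod_rpow_le_omega (cube_subset_closedCube hc)
  rw [Real.norm_of_nonneg (zpow_nonneg (omega_nonneg x) p), ← Real.rpow_intCast]
  refine (Real.rpow_le_rpow_of_nonpos h3 h4 (by exact_mod_cast hp.le)).trans (le_of_eq ?_)
  rw [← Real.finsetProd_rpow _ _ fun j _ => Real.rpow_nonneg (h2 j).le _]
  exact Finset.prod_congr rfl fun j _ => (Real.rpow_mul (h2 j).le _ _).symm

/-- A function continuous on the closed cube is integrable against an integrable power of the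
weight. -/
lemma integrableOn_mul_omega_zpow [NeZero d] {p : ℤ} (h : 0 < (d : ℤ) + 2 * p)
    {g : EuclideanSpace ℝ (Fin d) → ℝ} (hg : ContinuousOn g (closedCube d)) :
    IntegrableOn (fun x => g x * omega x ^ p) (cube d) := by
  obtain ⟨C, hC⟩ := isCompact_closedCube.exists_bound_of_continuousOn hg
  refine Integrable.bdd_mul (c := C) (integrableOn_omega_zpow h)
    ((hg.mono cube_subset_closedCube).aestronglyMeasurable measurableSet_cube) ?_
  filter_upwards [ae_restrict_mem measurableSet_cube] with x hx
  exact hC x (cube_subset_closedCube hx)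

end

/-! ### Periodic functions and integration by parts against singular weights. -/

section

variable {d : ℕ} {F : Type*} [NormedAddCommGroup F] [NormedSpace ℝ F]

/-- `C¹` functions on the closed cube with equal values at opposite points of the faces. -/
structure PeriodicC1 (f : EuclideanSpace ℝ (Fin d) → F) : Prop where
  contDiffOn : ContDiffOn ℝ 1 f (closedCube d)
  periodic : ∀ (j : Fin d), ∀ x ∈ closedCube d, x j = -π →
    f (x + EuclideanSpace.single j (2 * π)) = f x

namespace PeriodicC1

lemma continuousOn {f : EuclideanSpace ℝ (Fin d) → F} (hf : PeriodicC1 f) :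
    ContinuousOn f (closedCube d) := hf.contDiffOn.continuousOn

lemma differentiableOn {f : EuclideanSpace ℝ (Fin d) → F} (hf : PeriodicC1 f) :
    DifferentiableOn ℝ f (closedCube d) := hf.contDiffOn.differentiableOn one_ne_zero

lemma continuousOn_pd {f : EuclideanSpace ℝ (Fin d) → F} (hf : PeriodicC1 f) (j : Fin d) :
    ContinuousOn (pd j f) (closedCube d) :=
  (hf.contDiffOn.continuousOn_fderivWithin uniqueDiffOn_closedCube le_rfl).clm_apply
    continuousOn_const

lemma mul {A : Type*} [NormedRing A] [NormedAlgebra ℝ A] {f g : EuclideanSpace ℝ (Fin d) → A}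
    (hf : PeriodicC1 f) (hg : PeriodicC1 g) : PeriodicC1 fun x => f x * g x where
  contDiffOn := hf.contDiffOn.mul hg.contDiffOn
  periodic j x hx h := by rw [hf.periodic j x hx h, hg.periodic j x hx h]

/-- The integral of a partial derivative of a periodic function over the cube vanishes. -/
theorem integral_pd [CompleteSpace F] {f : EuclideanSpace ℝ (Fin d) → F} (hf : PeriodicC1 f)
    (j : Fin d) : ∫ x in cube d, pd j f x = 0 := by
  have hp := Real.pi_pos
  obtain ⟨n, rfl⟩ : ∃ n, d = n + 1 := ⟨d - 1, by have := j.pos; omega⟩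
  let L : (Fin (n + 1) → ℝ) →L[ℝ] EuclideanSpace ℝ (Fin (n + 1)) :=
    (EuclideanSpace.equiv (Fin (n + 1)) ℝ).symm
  have hmem : ∀ y ∈ Set.Icc (fun _ : Fin (n + 1) => -π) (fun _ => π), L y ∈ closedCube (n + 1) :=
    fun y hy i => ⟨hy.1 i, hy.2 i⟩
  have hpdc : ContinuousOn (fun y => pd j f (L y))
      (Set.Icc (fun _ : Fin (n + 1) => -π) (fun _ => π)) :=
    (hf.continuousOn_pd j).comp L.continuous.continuousOn hmem
  have hsum : ∀ y : Fin (n + 1) → ℝ, ∑ i, (if i = j then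
      (fderivWithin ℝ f (closedCube (n + 1)) (L y)).comp L else 0) (Pi.single i 1) =
      pd j f (L y) := by
    intro y
    rw [Finset.sum_eq_single j (fun i _ hi => by simp [hi]) (by simp)]
    simp only [if_true]
    rfl
  -- Divergence theorem for the field whose only nonzero component is the `j`-th one, equal to `f`;
  -- the two faces orthogonal to `e_j` then cancel by periodicity.
  have hdiv := integral_divergence_of_hasFDerivAt_off_countable'
    (fun _ : Fin (n + 1) => -π) (fun _ => π) (fun _ => by linarith)
    (fun i y => if i = j then f (L y) else 0)
    (fun i y => if i = j then (fderivWithin ℝ f (closedCube (n + 1)) (L y)).comp L else 0)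
    ∅ Set.countable_empty ?_ ?_ ?_
  · simp_rw [hsum] at hdiv
    have h1 := setIntegral_cube (fun y => pd j f (L y))
    have h2 : ∫ x in cube (n + 1), pd j f x = ∫ x in cube (n + 1), pd j f (L x.ofLp) := rfl
    have h5 : ∫ y in Set.univ.pi fun _ : Fin (n + 1) => Set.Ioo (-π) π, pd j f (L y) =
        ∫ y in Set.Icc (fun _ : Fin (n + 1) => -π) (fun _ => π), pd j f (L y) :=
      setIntegral_congr_set Measure.univ_pi_Ioo_ae_eq_Icc
    rw [h2, h1, h5, hdiv]
    refine Finset.sum_eq_zero fun i _ => ?_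
    by_cases hi : i = j
    · subst hi
      simp only [if_true]
      rw [sub_eq_zero]
      refine setIntegral_congr_fun measurableSet_Icc fun y hy => ?_
      have h3 : L (i.insertNth π y) =
          L (i.insertNth (-π) y) + EuclideanSpace.single i (2 * π) := by
        ext k
        rcases Fin.eq_self_or_eq_succAbove i k with rfl | ⟨k, rfl⟩
        · simp [L]; ring
        · simp [L]
      rw [h3]
      refine hf.periodic i _ (hmem _ ?_) (by simp [L])
      refine ⟨fun k => ?_, fun k => ?_⟩ <;>
      rcases Fin.eq_self_or_eq_succAbove i k with rfl | ⟨k, rfl⟩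
      · simp
      · simpa using hy.1 k
      · simp; linarith
      · simpa using hy.2 k
    · simp [hi]
  · intro i
    by_cases hi : i = j
    · simp only [hi, if_true]
      exact hf.continuousOn.comp L.continuous.continuousOn hmem
    · simp only [hi, if_false]
      exact continuousOn_const
  · intro y hy i
    by_cases hi : i = j
    · simp only [hi, if_true]
      have hy' : L y ∈ cube (n + 1) := fun k => hy.1 k (Set.mem_univ k)
      have h4 := (hf.differentiableOn (L y) (cube_subset_closedCube hy')).hasFDerivWithinAt.hasFDerivAt
        (closedCube_mem_nhds hy')
      exact h4.comp y L.hasFDerivAt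
    · simp only [hi, if_false]
      exact hasFDerivAt_const _ _
  · simp_rw [hsum]
    exact hpdc.integrableOn_compact isCompact_Icc

end PeriodicC1

lemma pd_mul {f g : EuclideanSpace ℝ (Fin d) → ℝ}
    {x : EuclideanSpace ℝ (Fin d)} (hx : x ∈ closedCube d) (hf : PeriodicC1 f) (hg : PeriodicC1 g)
    (j : Fin d) : pd j (fun y => f y * g y) x = f x * pd j g x + pd j f x * g x := by
  unfold pd
  rw [fderivWithin_fun_mul (uniqueDiffOn_closedCube x hx) (hf.differentiableOn x hx)
    (hg.differentiableOn x hx)]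
  simp [mul_comm]

lemma sin_half_sq_periodic {x : EuclideanSpace ℝ (Fin d)} {j : Fin d} (h : x j = -π) (i : Fin d) :
    sin ((x + EuclideanSpace.single j (2 * π)) i / 2) ^ 2 = sin (x i / 2) ^ 2 := by
  by_cases hi : i = j
  · subst hi
    have : (x + EuclideanSpace.single i (2 * π)) i / 2 = x i / 2 + π := by simp; ring
    rw [this, sin_add_pi, neg_sq]
  · simp [hi]

lemma omega_periodic {x : EuclideanSpace ℝ (Fin d)} {j : Fin d} (h : x j = -π) :
    omega (x + EuclideanSpace.single j (2 * π)) = omega x :=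
  Finset.sum_congr rfl fun i _ => sin_half_sq_periodic h i

lemma periodicC1_sin (i : Fin d) :
    PeriodicC1 fun x : EuclideanSpace ℝ (Fin d) => sin (x i) / 2 where
  contDiffOn := by
    apply ContDiff.contDiffOn
    fun_prop
  periodic j x _ _ := by
    by_cases hi : i = j
    · subst hi; simp
    · simp [hi]

lemma periodicC1_add_zpow {ε : ℝ} (hε : 0 < ε) (p : ℤ) :
    PeriodicC1 fun x : EuclideanSpace ℝ (Fin d) => (omega x + ε) ^ p where
  contDiffOn := by
    intro x _
    have h0 : omega x + ε ≠ 0 := by have := omega_nonneg x; positivity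
    have h1 : ContDiffAt ℝ 1 (fun t : ℝ => t ^ p) (omega x + ε) := by
      rcases le_total 0 p with h | h
      · lift p to ℕ using h
        simp only [zpow_natCast]
        fun_prop
      · obtain ⟨n, rfl⟩ : ∃ n : ℕ, p = -n := ⟨p.natAbs, by omega⟩
        simp only [zpow_neg, zpow_natCast]
        exact (contDiffAt_id.pow n).inv (by simpa using pow_ne_zero n h0)
    exact (h1.comp x ((contDiff_omega.add contDiff_const).contDiffAt)).contDiffWithinAt
  periodic j x _ h := by rw [omega_periodic h]

lemma pd_add_zpow {ε : ℝ} (hε : 0 < ε) (p : ℤ) (j : Fin d) {x : EuclideanSpace ℝ (Fin d)}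
    (hx : x ∈ closedCube d) :
    pd j (fun y => (omega y + ε) ^ p) x =
      p * (omega x + ε) ^ (p - 1) * (sin (x j) / 2) := by
  have h0 : omega x + ε ≠ 0 := by have := omega_nonneg x; positivity
  have h1 := (hasDerivAt_zpow p (omega x + ε) (Or.inl h0)).comp_hasFDerivAt x
    ((hasFDerivAt_omega x).add_const ε)
  have h2 : HasFDerivAt (fun y : EuclideanSpace ℝ (Fin d) => (omega y + ε) ^ p) _ x := h1
  unfold pd
  rw [h2.hasFDerivWithinAt.fderivWithin (uniqueDiffOn_closedCube x hx)]
  simp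

lemma zpow_le_zpow_base_of_nonpos {a b : ℝ} (ha : 0 < a) (hab : a ≤ b) {p : ℤ} (hp : p ≤ 0) :
    b ^ p ≤ a ^ p := by
  obtain ⟨n, rfl⟩ : ∃ n : ℕ, p = -n := ⟨p.natAbs, by omega⟩
  simp only [zpow_neg, zpow_natCast]
  gcongr

/-- Integration by parts against a singular power of the weight. -/
theorem PeriodicC1.integral_pd_mul_zpow [NeZero d] {f : EuclideanSpace ℝ (Fin d) → ℝ}
    (hf : PeriodicC1 f) (j : Fin d) {p : ℤ} (hp : p ≤ 0)
    (h1 : IntegrableOn (fun x => pd j f x * omega x ^ p) (cube d))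
    (h2 : IntegrableOn (fun x => f x * (sin (x j) / 2) * omega x ^ (p - 1)) (cube d)) :
    ∫ x in cube d, pd j f x * omega x ^ p =
      -p * ∫ x in cube d, f x * (sin (x j) / 2) * omega x ^ (p - 1) := by
  suffices h : ∫ x in cube d, (pd j f x * omega x ^ p +
      p * (f x * (sin (x j) / 2) * omega x ^ (p - 1))) = 0 by
    rw [integral_add h1 (h2.const_mul _), integral_const_mul] at h
    linarith
  -- The weight is regularised to `ω + ε`, which never vanishes, so that `f (ω + ε)^p` is periodic
  -- and `C¹` and `integral_pd` applies to it.
  let ε : ℕ → ℝ := fun n => 1 / ((n : ℝ) + 1)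
  have hε : ∀ n, 0 < ε n := fun n => by positivity
  have hε0 : Filter.Tendsto ε Filter.atTop (nhds 0) := tendsto_one_div_add_atTop_nhds_zero_nat
  have hzero : ∀ n, ∫ x in cube d, (pd j f x * (omega x + ε n) ^ p +
      p * (f x * (sin (x j) / 2) * (omega x + ε n) ^ (p - 1))) = 0 := by
    intro n
    rw [← (hf.mul (periodicC1_add_zpow (hε n) p)).integral_pd j]
    refine setIntegral_congr_fun measurableSet_cube fun x hx => ?_
    have hx' := cube_subset_closedCube hx
    simp only
    rw [pd_mul hx' hf (periodicC1_add_zpow (hε n) p), pd_add_zpow (hε n) p j hx']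
    ring
  have hmeas : ∀ n, AEStronglyMeasurable (fun x => pd j f x * (omega x + ε n) ^ p +
      p * (f x * (sin (x j) / 2) * (omega x + ε n) ^ (p - 1))) (volume.restrict (cube d)) := by
    intro n
    refine ContinuousOn.aestronglyMeasurable ?_ measurableSet_cube
    refine ContinuousOn.mono ?_ cube_subset_closedCube
    exact ((hf.continuousOn_pd j).mul (periodicC1_add_zpow (hε n) p).continuousOn).add
      (continuousOn_const.mul ((hf.continuousOn.mul (periodicC1_sin j).continuousOn).mul
        (periodicC1_add_zpow (hε n) (p - 1)).continuousOn))
  -- Both exponents `p` and `p - 1` are nonpositive, so `(ω + ε)^q ≤ ω^q` and the unregularised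
  -- integrand dominates.
  have hlim := tendsto_integral_of_dominated_convergence
    (fun x => ‖pd j f x * omega x ^ p‖ +
      ‖(p : ℝ) * (f x * (sin (x j) / 2) * omega x ^ (p - 1))‖) hmeas
    (h1.norm.add (h2.const_mul _).norm)
    (f := fun x => pd j f x * omega x ^ p +
      p * (f x * (sin (x j) / 2) * omega x ^ (p - 1))) ?_ ?_
  · simp_rw [hzero] at hlim
    exact tendsto_nhds_unique hlim tendsto_const_nhds
  · intro n
    filter_upwards [ae_cube] with x hx
    have hq : ∀ q : ℤ, q ≤ 0 → ‖(omega x + ε n) ^ q‖ ≤ ‖omega x ^ q‖ := by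
      intro q hq
      have := hε n
      rw [Real.norm_of_nonneg (by positivity [omega_nonneg x]), Real.norm_of_nonneg
        (zpow_nonneg hx.2.le _)]
      exact zpow_le_zpow_base_of_nonpos hx.2 (by linarith) hq
    refine (norm_add_le _ _).trans (add_le_add ?_ ?_)
    · rw [norm_mul, norm_mul]
      exact mul_le_mul_of_nonneg_left (hq p hp) (norm_nonneg _)
    · rw [norm_mul, norm_mul, norm_mul _ (_ * _), norm_mul _ (omega x ^ _)]
      exact mul_le_mul_of_nonneg_left
        (mul_le_mul_of_nonneg_left (hq (p - 1) (by omega)) (norm_nonneg _)) (norm_nonneg _)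
  · filter_upwards [ae_cube] with x hx
    have hq : ∀ q : ℤ, Filter.Tendsto (fun n => (omega x + ε n) ^ q) Filter.atTop
        (nhds (omega x ^ q)) := by
      intro q
      have h3 : Filter.Tendsto (fun n => omega x + ε n) Filter.atTop (nhds (omega x)) := by
        simpa using hε0.const_add (omega x)
      exact h3.zpow₀ q (Or.inl hx.2.ne')
    exact ((hq p).const_mul _).add (((hq (p - 1)).const_mul _).const_mul _)

end

/-! ### Fourier series on the cube and the Poincaré inequality. -/

section

variable {d : ℕ}

section Parseval

open scoped Pointwise

/-- The normalised measure on the unit circle, as in Mathlib's multivariate Fourier series. -/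
noncomputable local instance measureSpaceUnitAddCircle : MeasureSpace UnitAddCircle :=
  ⟨AddCircle.haarAddCircle⟩

noncomputable local instance isProbabilityMeasureUnitAddCircle :
    IsProbabilityMeasure (volume : Measure UnitAddCircle) :=
  inferInstanceAs (IsProbabilityMeasure AddCircle.haarAddCircle)

/-- The function on the unit torus represented by a function on the box `(-π, π]^d`. -/
noncomputable def toTorus (g : (Fin d → ℝ) → ℂ) (t : UnitAddTorus (Fin d)) : ℂ :=
  g ((2 * π) • (UnitAddTorus.measurableEquivPiIoc (fun _ => -(1 / 2)) t).1)

lemma toTorus_coe (g : (Fin d → ℝ) → ℂ) {y : Fin d → ℝ}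
    (hy : ∀ i, y i ∈ Set.Ioc (-(1 / 2) : ℝ) (-(1 / 2) + 1)) :
    toTorus g (fun i => (y i : UnitAddCircle)) = g ((2 * π) • y) := by
  have h := (UnitAddTorus.measurableEquivPiIoc (fun _ : Fin d => -(1 / 2 : ℝ))).apply_symm_apply
    ⟨y, hy⟩
  rw [UnitAddTorus.coe_symm_measurableEquivPiIoc_apply] at h
  unfold toTorus
  rw [h]

/-- Change of variables from the unit torus, with fundamental domain `(-1/2, 1/2]^d`, to the cube:
scaling by `2π` gives the factor `(2π)^(-d)`, and the boundary is negligible. -/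
lemma integral_toTorus_comp {V : Type*} [NormedAddCommGroup V] [NormedSpace ℝ V]
    (Φ : UnitAddTorus (Fin d) → V) (G : (Fin d → ℝ) → V)
    (h : ∀ y : Fin d → ℝ, (∀ i, y i ∈ Set.Ioc (-(1 / 2) : ℝ) (-(1 / 2) + 1)) →
      Φ (fun i => (y i : UnitAddCircle)) = G ((2 * π) • y)) :
    ∫ t, Φ t = ((2 * π) ^ d)⁻¹ • ∫ x in cube d, G x.ofLp := by
  have hp := Real.pi_pos
  have hset : {y : Fin d → ℝ | ∀ i, y i ∈ Set.Ioc (-(1 / 2) : ℝ) (-(1 / 2) + 1)} =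
      Set.univ.pi fun _ => Set.Ioc (-(1 / 2) : ℝ) (-(1 / 2) + 1) := by ext; simp
  rw [UnitAddTorus.integral_preimage Φ (fun _ => -(1 / 2)), hset,
    setIntegral_congr_fun (g := fun y => G ((2 * π) • y))
      (MeasurableSet.univ_pi fun _ => measurableSet_Ioc) (fun y hy => h y fun i => hy i trivial),
    Measure.setIntegral_comp_smul_of_pos _ _ _ (by positivity : (0 : ℝ) < 2 * π), setIntegral_cube]
  have hset2 : (2 * π) • (Set.univ.pi fun _ : Fin d => Set.Ioc (-(1 / 2) : ℝ) (-(1 / 2) + 1)) =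
      Set.univ.pi fun _ => Set.Ioc (-π) π := by
    ext y
    rw [Set.mem_smul_set_iff_inv_smul_mem₀ (by positivity : (2 * π) ≠ 0)]
    simp only [Set.mem_univ_pi, Pi.smul_apply, smul_eq_mul, Set.mem_Ioc]
    refine forall_congr' fun i => and_congr ?_ ?_
    · rw [lt_inv_mul_iff₀ (by positivity)]
      ring_nf
    · rw [inv_mul_le_iff₀ (by positivity)]
      ring_nf
  rw [hset2]
  have h5 : ∫ y in Set.univ.pi fun _ : Fin d => Set.Ioc (-π) π, G y =
      ∫ y in Set.univ.pi fun _ : Fin d => Set.Ioo (-π) π, G y :=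
    setIntegral_congr_set
      (Measure.univ_pi_Ioc_ae_eq_Icc.trans Measure.univ_pi_Ioo_ae_eq_Icc.symm)
  rw [h5]
  simp

/-- The exponential `x ↦ e^{-i n·x}`. -/
noncomputable def character (n : Fin d → ℤ) (x : EuclideanSpace ℝ (Fin d)) : ℂ :=
  Complex.exp (-(Complex.I * ∑ j, (n j : ℂ) * (x j : ℂ)))

/-- Parseval's identity on the cube. -/
theorem hasSum_sq_norm_integral_character {g : EuclideanSpace ℝ (Fin d) → ℂ}
    (hg : ContinuousOn g (closedCube d)) :
    HasSum (fun n : Fin d → ℤ => (((2 * π) ^ d)⁻¹ * ‖∫ x in cube d, g x * character n x‖) ^ 2)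
      (((2 * π) ^ d)⁻¹ * ∫ x in cube d, ‖g x‖ ^ 2) := by
  classical
  have hp := Real.pi_pos
  obtain ⟨C, hC⟩ := isCompact_closedCube.exists_bound_of_continuousOn hg
  -- Continuity is known only on the closed cube; the extension by zero is measurable and bounded
  -- everywhere, hence square integrable on the torus.
  let g₀ : EuclideanSpace ℝ (Fin d) → ℂ := (closedCube d).indicator g
  have hg₀m : Measurable g₀ :=
    hg.measurable_piecewise continuousOn_const isClosed_closedCube.measurableSet
  have hg₀b : ∀ x, ‖g₀ x‖ ≤ max C 0 := by
    intro x
    by_cases hx : x ∈ closedCube d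
    · simp only [g₀, Set.indicator_of_mem hx]; exact (hC x hx).trans (le_max_left _ _)
    · simp [g₀, Set.indicator_of_notMem hx]
  have hg₀e : ∀ x ∈ cube d, g₀ x = g x := fun x hx =>
    Set.indicator_of_mem (cube_subset_closedCube hx) g
  let G : UnitAddTorus (Fin d) → ℂ := toTorus fun y => g₀ (WithLp.toLp 2 y)
  have hGm : Measurable G := by
    refine hg₀m.comp ((EuclideanSpace.equiv (Fin d) ℝ).symm.continuous.measurable.comp ?_)
    have h := measurable_subtype_coe.comp
      (UnitAddTorus.measurableEquivPiIoc (fun _ : Fin d => -(1 / 2 : ℝ))).measurable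
    exact h.const_smul (2 * π)
  have hGL : MemLp G 2 (volume : Measure (UnitAddTorus (Fin d))) :=
    MemLp.of_bound hGm.aestronglyMeasurable (max C 0) (Filter.Eventually.of_forall fun t => hg₀b _)
  have hsum := UnitAddTorus.hasSum_sq_mFourierCoeff (hGL.toLp G)
  have h1 : ∫ t, ‖(hGL.toLp G) t‖ ^ 2 = ((2 * π) ^ d)⁻¹ * ∫ x in cube d, ‖g x‖ ^ 2 := by
    have : ∫ t, ‖(hGL.toLp G) t‖ ^ 2 = ∫ t, ‖G t‖ ^ 2 :=
      integral_congr_ae (by filter_upwards [hGL.coeFn_toLp] with t ht; rw [ht])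
    rw [this, integral_toTorus_comp _ (fun y => ‖g₀ (WithLp.toLp 2 y)‖ ^ 2)
      (fun y hy => by simp only [G]; rw [toTorus_coe _ hy]), smul_eq_mul]
    congr 1
    exact setIntegral_congr_fun measurableSet_cube fun x hx => by
      have := hg₀e x hx
      simp only; rw [← this]
  have h2 : ∀ n, ‖UnitAddTorus.mFourierCoeff (hGL.toLp G) n‖ =
      ((2 * π) ^ d)⁻¹ * ‖∫ x in cube d, g x * character n x‖ := by
    intro n
    have : UnitAddTorus.mFourierCoeff (hGL.toLp G) n = UnitAddTorus.mFourierCoeff G n :=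
      integral_congr_ae (by filter_upwards [hGL.coeFn_toLp] with t ht; rw [ht])
    rw [this]
    unfold UnitAddTorus.mFourierCoeff
    rw [integral_toTorus_comp _ (fun y => character n (WithLp.toLp 2 y) * g₀ (WithLp.toLp 2 y))
      (fun y hy => ?_), norm_smul, Real.norm_of_nonneg (by positivity)]
    · congr 2
      exact setIntegral_congr_fun measurableSet_cube fun x hx => by
        have := hg₀e x hx
        simp only; rw [← this]; exact mul_comm _ _
    · simp only [G]
      rw [toTorus_coe _ hy, smul_eq_mul]
      congr 1
      simp only [UnitAddTorus.mFourier, ContinuousMap.coe_mk, character, fourier_coe_apply,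
        ← Complex.exp_sum]
      congr 1
      rw [Finset.mul_sum, ← Finset.sum_neg_distrib]
      refine Finset.sum_congr rfl fun j _ => ?_
      simp
      ring
  simp_rw [h2] at hsum
  rwa [h1] at hsum

end Parseval

lemma contDiff_character (n : Fin d → ℤ) {k : WithTop ℕ∞} : ContDiff ℝ k (character n) := by
  have h : ∀ j, ContDiff ℝ k fun x : EuclideanSpace ℝ (Fin d) => ((x j : ℝ) : ℂ) := fun j =>
    Complex.ofRealCLM.contDiff.comp (EuclideanSpace.proj j : EuclideanSpace ℝ (Fin d) →L[ℝ] ℝ).contDiff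
  unfold character
  exact (contDiff_const.mul (ContDiff.sum fun j _ => contDiff_const.mul (h j))).neg.cexp

lemma periodicC1_character (n : Fin d → ℤ) : PeriodicC1 (character n) where
  contDiffOn := (contDiff_character n).contDiffOn
  periodic j x _ _ := by
    unfold character
    have h1 : ∑ i, (n i : ℂ) * (((x + EuclideanSpace.single j (2 * π)) i : ℝ) : ℂ) =
        ∑ i, (n i : ℂ) * ((x i : ℝ) : ℂ) + n j * (2 * π) := by
      have h2 : ∀ i, (n i : ℂ) * (((x + EuclideanSpace.single j (2 * π)) i : ℝ) : ℂ) =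
          n i * ((x i : ℝ) : ℂ) + if i = j then (n i : ℂ) * (2 * π) else 0 := by
        intro i
        by_cases hi : i = j <;> simp [hi, mul_add]
      simp_rw [h2]
      simp [Finset.sum_add_distrib]
    rw [h1]
    refine Complex.exp_eq_exp_iff_exists_int.2 ⟨-n j, ?_⟩
    push_cast
    ring

lemma pd_character (n : Fin d → ℤ) (j : Fin d) {x : EuclideanSpace ℝ (Fin d)}
    (hx : x ∈ closedCube d) :
    pd j (character n) x = -(Complex.I * n j) * character n x := by
  have h : ∀ i, HasFDerivAt (fun x : EuclideanSpace ℝ (Fin d) => ((x i : ℝ) : ℂ))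
      (Complex.ofRealCLM.comp (EuclideanSpace.proj i : EuclideanSpace ℝ (Fin d) →L[ℝ] ℝ)) x :=
    fun i => (Complex.ofRealCLM.comp
      (EuclideanSpace.proj i : EuclideanSpace ℝ (Fin d) →L[ℝ] ℝ)).hasFDerivAt
  have h2 := ((HasFDerivAt.fun_sum (u := Finset.univ)
    fun i _ => (h i).const_mul (n i : ℂ)).const_mul Complex.I).neg.cexp
  have h3 : HasFDerivAt (character n) _ x := h2
  unfold pd
  rw [h3.hasFDerivWithinAt.fderivWithin (uniqueDiffOn_closedCube x hx)]
  simp [character, apply_ite]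
  ring

lemma pd_mul_complex {f g : EuclideanSpace ℝ (Fin d) → ℂ}
    {x : EuclideanSpace ℝ (Fin d)} (hx : x ∈ closedCube d) (hf : PeriodicC1 f) (hg : PeriodicC1 g)
    (j : Fin d) : pd j (fun y => f y * g y) x = f x * pd j g x + pd j f x * g x := by
  unfold pd
  rw [fderivWithin_fun_mul (uniqueDiffOn_closedCube x hx) (hf.differentiableOn x hx)
    (hg.differentiableOn x hx)]
  simp [mul_comm]

lemma integrableOn_cube_of_continuousOn {V : Type*} [NormedAddCommGroup V]
    {g : EuclideanSpace ℝ (Fin d) → V} (hg : ContinuousOn g (closedCube d)) :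
    IntegrableOn g (cube d) :=
  (hg.integrableOn_compact isCompact_closedCube).mono_set cube_subset_closedCube

lemma integral_pd_mul_character {f : EuclideanSpace ℝ (Fin d) → ℂ} (hf : PeriodicC1 f)
    (j : Fin d) (n : Fin d → ℤ) :
    ∫ x in cube d, pd j f x * character n x =
      Complex.I * n j * ∫ x in cube d, f x * character n x := by
  have hχ := periodicC1_character n
  have h := (hf.mul hχ).integral_pd j
  have h1 : ∫ x in cube d, pd j (fun x => f x * character n x) x =
      ∫ x in cube d, (pd j f x * character n x - Complex.I * n j * (f x * character n x)) := by
    refine setIntegral_congr_fun measurableSet_cube fun x hx => ?_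
    have hx' := cube_subset_closedCube hx
    rw [pd_mul_complex hx' hf hχ, pd_character n j hx']
    ring
  rw [h1, integral_sub, integral_const_mul, sub_eq_zero] at h
  · exact h
  · exact integrableOn_cube_of_continuousOn ((hf.continuousOn_pd j).mul hχ.continuousOn)
  · exact integrableOn_cube_of_continuousOn
      (continuousOn_const.mul (hf.continuousOn.mul hχ.continuousOn))

/-- The Poincaré inequality on the torus of side `2π`. -/
theorem poincare {f : EuclideanSpace ℝ (Fin d) → ℂ} (hf : PeriodicC1 f)
    (h0 : ∫ x in cube d, f x = 0) :
    ∫ x in cube d, ‖f x‖ ^ 2 ≤ ∫ x in cube d, ∑ j, ‖pd j f x‖ ^ 2 := by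
  have hp := Real.pi_pos
  have h1 := hasSum_sq_norm_integral_character hf.continuousOn
  have h2 := hasSum_sum (s := (Finset.univ : Finset (Fin d)))
    fun j _ => hasSum_sq_norm_integral_character (hf.continuousOn_pd j)
  have h3 := hasSum_le (fun n => ?_) h1 h2
  · rw [← Finset.mul_sum, ← integral_finsetSum] at h3
    · exact le_of_mul_le_mul_left h3 (by positivity)
    · intro j _
      exact integrableOn_cube_of_continuousOn ((hf.continuousOn_pd j).norm.pow 2)
  · simp_rw [integral_pd_mul_character hf, norm_mul]
    -- The zero mode vanishes because the mean does; for every other mode some `|n_j| ≥ 1`, and that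
    -- partial derivative alone dominates the coefficient of `f`.
    by_cases hn : n = 0
    · subst hn
      simp [character, h0]
    · obtain ⟨j, hj⟩ : ∃ j, n j ≠ 0 := by
        by_contra! h
        exact hn (funext h)
      refine le_trans ?_ (Finset.single_le_sum (fun i _ => sq_nonneg _) (Finset.mem_univ j))
      have h4 : (1 : ℝ) ≤ |(n j : ℝ)| := by exact_mod_cast Int.one_le_abs hj
      have h5 : ‖(n j : ℂ)‖ = |(n j : ℝ)| := by simp
      rw [h5, Complex.norm_I, one_mul]
      refine pow_le_pow_left₀ (by positivity) ?_ 2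
      refine mul_le_mul_of_nonneg_left ?_ (by positivity)
      exact le_mul_of_one_le_left (norm_nonneg _) h4

end

/-! ### Stability of smooth periodic functions under derivatives and Laplacians. -/

section

variable {d : ℕ}

lemma add_single_mem_closedCube {x : EuclideanSpace ℝ (Fin d)} (hx : x ∈ closedCube d) {j : Fin d}
    (h : x j = -π) : x + EuclideanSpace.single j (2 * π) ∈ closedCube d := by
  have hp := Real.pi_pos
  intro i
  by_cases hi : i = j
  · subst hi
    constructor <;> simp [h] <;> linarith
  · simpa [hi] using hx i

namespace SmoothPeriodic

variable {f : EuclideanSpace ℝ (Fin d) → ℂ}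

lemma periodicC1 (hf : SmoothPeriodic f) : PeriodicC1 f where
  contDiffOn := hf.contDiffOn.of_le (by exact_mod_cast le_top)
  periodic j x hx h := by
    have := congrArg (fun T => T fun _ => 0) (hf.periodic 0 j x hx h)
    simpa using this

lemma congr {g : EuclideanSpace ℝ (Fin d) → ℂ} (hf : SmoothPeriodic f)
    (h : ∀ x ∈ closedCube d, g x = f x) : SmoothPeriodic g where
  contDiffOn := hf.contDiffOn.congr h
  periodic n j x hx hxj := by
    rw [iteratedFDerivWithin_congr h hx n,
      iteratedFDerivWithin_congr h (add_single_mem_closedCube hx hxj) n]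
    exact hf.periodic n j x hx hxj

lemma sum {ι : Type*} {s : Finset ι} {g : ι → EuclideanSpace ℝ (Fin d) → ℂ}
    (hg : ∀ i ∈ s, SmoothPeriodic (g i)) : SmoothPeriodic fun x => ∑ i ∈ s, g i x where
  contDiffOn := ContDiffOn.sum fun i hi => (hg i hi).contDiffOn
  periodic n j x hx h := by
    have key : ∀ y ∈ closedCube d,
        iteratedFDerivWithin ℝ n (fun x => ∑ i ∈ s, g i x) (closedCube d) y =
          ∑ i ∈ s, iteratedFDerivWithin ℝ n (g i) (closedCube d) y := fun y hy =>
      iteratedFDerivWithin_fun_sum_apply uniqueDiffOn_closedCube hy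
        fun i hi => ((hg i hi).contDiffOn.of_le (by exact_mod_cast le_top)) y hy
    rw [key x hx, key _ (add_single_mem_closedCube hx h)]
    exact Finset.sum_congr rfl fun i hi => (hg i hi).periodic n j x hx h

lemma contDiffOn_fderivWithin (hf : SmoothPeriodic f) :
    ContDiffOn ℝ ∞ (fderivWithin ℝ f (closedCube d)) (closedCube d) :=
  hf.contDiffOn.fderivWithin uniqueDiffOn_closedCube (by simp)

lemma pd (hf : SmoothPeriodic f) (i : Fin d) : SmoothPeriodic (pd i f) where
  contDiffOn := hf.contDiffOn_fderivWithin.clm_apply contDiffOn_const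
  periodic n j x hx h := by
    let L : (EuclideanSpace ℝ (Fin d) →L[ℝ] ℂ) →L[ℝ] ℂ :=
      ContinuousLinearMap.apply ℝ ℂ (EuclideanSpace.single i 1)
    -- The `n`-th derivative of `∂_i f` is the `(n+1)`-st derivative of `f` with `e_i` in the last
    -- slot, so periodicity at order `n + 1` is what is used.
    have key : ∀ y ∈ closedCube d, ∀ v : Fin n → EuclideanSpace ℝ (Fin d),
        iteratedFDerivWithin ℝ n (TorusHardy.pd i f) (closedCube d) y v =
          iteratedFDerivWithin ℝ (n + 1) f (closedCube d) y
            (Fin.snoc v (EuclideanSpace.single i 1)) := by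
      intro y hy v
      have h1 : TorusHardy.pd i f = L ∘ fderivWithin ℝ f (closedCube d) := rfl
      rw [h1, L.iteratedFDerivWithin_comp_left (hf.contDiffOn_fderivWithin y hy)
        uniqueDiffOn_closedCube hy (by exact_mod_cast le_top),
        iteratedFDerivWithin_succ_apply_right uniqueDiffOn_closedCube hy]
      simp [L]
    ext v
    rw [key x hx, key _ (add_single_mem_closedCube hx h), hf.periodic (n + 1) j x hx h]

end SmoothPeriodic

lemma laplacianWithin_eq_sum_pd {f : EuclideanSpace ℝ (Fin d) → ℂ}
    {x : EuclideanSpace ℝ (Fin d)} (hf : SmoothPeriodic f) (hx : x ∈ closedCube d) :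
    InnerProductSpace.laplacianWithin f (closedCube d) x = ∑ j, pd j (pd j f) x := by
  rw [InnerProductSpace.laplacianWithin_eq_iteratedFDerivWithin_orthonormalBasis f
    uniqueDiffOn_closedCube hx (EuclideanSpace.basisFun (Fin d) ℝ)]
  refine Finset.sum_congr rfl fun j _ => ?_
  rw [iteratedFDerivWithin_two_apply f uniqueDiffOn_closedCube hx]
  have h1 := hf.contDiffOn_fderivWithin.differentiableOn (by simp) x hx
  have h2 := (h1.hasFDerivWithinAt.clm_apply
    (hasFDerivWithinAt_const (EuclideanSpace.single j (1 : ℝ)) x (closedCube d))).fderivWithin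
    (uniqueDiffOn_closedCube x hx)
  unfold pd
  rw [h2]
  simp

lemma SmoothPeriodic.laplacianWithin {f : EuclideanSpace ℝ (Fin d) → ℂ} (hf : SmoothPeriodic f) :
    SmoothPeriodic (InnerProductSpace.laplacianWithin f (closedCube d)) :=
  (SmoothPeriodic.sum (s := Finset.univ) fun j _ => (hf.pd j).pd j).congr
    fun _ hx => laplacianWithin_eq_sum_pd hf hx

/-- The Laplacian is a sum of derivatives of periodic functions. Its zero mean keeps the Poincaré
inequality available for every iterate. -/
lemma SmoothPeriodic.integral_laplacianWithin {f : EuclideanSpace ℝ (Fin d) → ℂ}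
    (hf : SmoothPeriodic f) :
    ∫ x in cube d, InnerProductSpace.laplacianWithin f (closedCube d) x = 0 := by
  rw [setIntegral_congr_fun measurableSet_cube fun x hx =>
    laplacianWithin_eq_sum_pd hf (cube_subset_closedCube hx), integral_finsetSum]
  · exact Finset.sum_eq_zero fun j _ => (hf.pd j).periodicC1.integral_pd j
  · exact fun j _ => integrableOn_cube_of_continuousOn ((hf.pd j).periodicC1.continuousOn_pd j)

lemma iterLaplacian_succ (m : ℕ) (f : EuclideanSpace ℝ (Fin d) → ℂ) :
    iterLaplacian (m + 1) f =
      InnerProductSpace.laplacianWithin (iterLaplacian m f) (closedCube d) :=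
  Function.iterate_succ_apply' _ _ _

lemma SmoothPeriodic.iterLaplacian {f : EuclideanSpace ℝ (Fin d) → ℂ} (hf : SmoothPeriodic f)
    (m : ℕ) : SmoothPeriodic (iterLaplacian m f) := by
  induction m with
  | zero => exact hf
  | succ m ih => rw [iterLaplacian_succ]; exact ih.laplacianWithin

lemma SmoothPeriodic.integral_iterLaplacian {f : EuclideanSpace ℝ (Fin d) → ℂ}
    (hf : SmoothPeriodic f) (h0 : ∫ x in cube d, f x = 0) (m : ℕ) :
    ∫ x in cube d, TorusHardy.iterLaplacian m f x = 0 := by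
  cases m with
  | zero => exact h0
  | succ m => rw [iterLaplacian_succ]; exact (hf.iterLaplacian m).integral_laplacianWithin

end

/-! ### Weighted integrals. -/

section

variable {d : ℕ}

/-- The integral of `g` over the cube against the power `ω^p` of the weight. -/
noncomputable def weightedIntegral (p : ℤ) (g : EuclideanSpace ℝ (Fin d) → ℝ) : ℝ :=
  ∫ x in cube d, g x * omega x ^ p

lemma weightedIntegral_nonneg (p : ℤ) {g : EuclideanSpace ℝ (Fin d) → ℝ} (hg : ∀ x, 0 ≤ g x) :
    0 ≤ weightedIntegral p g :=
  integral_nonneg fun x => mul_nonneg (hg x) (zpow_nonneg (omega_nonneg x) p)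

/-- From `ω ≤ d`. Trading a power of the weight in this way is the source of the powers of `d` in
`constSum`. -/
lemma weightedIntegral_succ_le [NeZero d] {p : ℤ} (h : 0 < (d : ℤ) + 2 * p)
    {g : EuclideanSpace ℝ (Fin d) → ℝ} (hc : ContinuousOn g (closedCube d)) (hg : ∀ x, 0 ≤ g x) :
    weightedIntegral (p + 1) g ≤ d * weightedIntegral p g := by
  unfold weightedIntegral
  rw [← integral_const_mul]
  refine integral_mono_ae (integrableOn_mul_omega_zpow (by omega) hc)
    ((integrableOn_mul_omega_zpow h hc).const_mul _) ?_
  filter_upwards [ae_cube] with x hx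
  rw [zpow_add_one₀ hx.2.ne']
  have h1 := omega_le x
  have h2 : 0 ≤ g x * omega x ^ p := mul_nonneg (hg x) (zpow_nonneg hx.2.le p)
  nlinarith

lemma gradSq_nonneg (f : EuclideanSpace ℝ (Fin d) → ℂ) (x : EuclideanSpace ℝ (Fin d)) :
    0 ≤ gradSq f x := Finset.sum_nonneg fun _ _ => sq_nonneg _

lemma PeriodicC1.continuousOn_gradSq {f : EuclideanSpace ℝ (Fin d) → ℂ} (hf : PeriodicC1 f) :
    ContinuousOn (gradSq f) (closedCube d) :=
  continuousOn_finsetSum _ fun j _ => (hf.continuousOn_pd j).norm.pow 2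

lemma PeriodicC1.inner {f g : EuclideanSpace ℝ (Fin d) → ℂ} (hf : PeriodicC1 f)
    (hg : PeriodicC1 g) : PeriodicC1 fun x => inner ℝ (f x) (g x) where
  contDiffOn := hf.contDiffOn.inner ℝ hg.contDiffOn
  periodic j x hx h := by rw [hf.periodic j x hx h, hg.periodic j x hx h]

lemma pd_inner {f g : EuclideanSpace ℝ (Fin d) → ℂ}
    {x : EuclideanSpace ℝ (Fin d)} (hx : x ∈ closedCube d) (hf : PeriodicC1 f) (hg : PeriodicC1 g)
    (j : Fin d) : pd j (fun y => inner ℝ (f y) (g y)) x =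
      inner ℝ (f x) (pd j g x) + inner ℝ (pd j f x) (g x) := by
  unfold pd
  rw [((hf.differentiableOn x hx).hasFDerivWithinAt.inner ℝ
    (hg.differentiableOn x hx).hasFDerivWithinAt).fderivWithin (uniqueDiffOn_closedCube x hx)]
  simp [fderivInnerCLM_apply]

/-- The function `Re (f̄ ∇f · ∇ω)`. -/
noncomputable def radialTerm (f : EuclideanSpace ℝ (Fin d) → ℂ) (x : EuclideanSpace ℝ (Fin d)) :
    ℝ := ∑ j, inner ℝ (f x) (pd j f x) * (sin (x j) / 2)

/-- The function `|f|² |∇ω|²`. -/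
noncomputable def radialSq (f : EuclideanSpace ℝ (Fin d) → ℂ) (x : EuclideanSpace ℝ (Fin d)) :
    ℝ := ‖f x‖ ^ 2 * ∑ j, (sin (x j) / 2) ^ 2

lemma PeriodicC1.continuousOn_normSq {f : EuclideanSpace ℝ (Fin d) → ℂ}
    (hf : PeriodicC1 f) :
    ContinuousOn (fun x => ‖f x‖ ^ 2) (closedCube d) := hf.continuousOn.norm.pow 2

lemma PeriodicC1.continuousOn_radialTerm {f : EuclideanSpace ℝ (Fin d) → ℂ}
    (hf : PeriodicC1 f) :
    ContinuousOn (radialTerm f) (closedCube d) :=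
  continuousOn_finsetSum _ fun j _ =>
    (hf.continuousOn.inner (hf.continuousOn_pd j)).mul (periodicC1_sin j).continuousOn

/-! ### First order identities and the Hardy step. -/

section FirstOrder

variable [NeZero d] {f : EuclideanSpace ℝ (Fin d) → ℂ} {p : ℤ}

/-- Since `|∇ω|² ≤ ω`, the sine factors gain a power of the weight: exponent `p - 1` is admissible
under the integrability condition for `p`. -/
lemma integrableOn_radialSq_aux (hf : PeriodicC1 f) (h : 0 < (d : ℤ) + 2 * p) (j : Fin d) :
    IntegrableOn (fun x => ‖f x‖ ^ 2 * (sin (x j) / 2) ^ 2 * omega x ^ (p - 1)) (cube d) := by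
  have hp' : ∀ᵐ x ∂(volume.restrict (cube d)), 0 ≤ omega x ^ (p - 1) :=
    Filter.Eventually.of_forall fun x => zpow_nonneg (omega_nonneg x) _
  refine Integrable.mono' (integrableOn_mul_omega_zpow h hf.continuousOn_normSq) ?_ ?_
  · refine AEStronglyMeasurable.mul ?_ (measurable_omega_zpow _).aestronglyMeasurable
    exact ((hf.continuousOn_normSq.mul ((periodicC1_sin j).continuousOn.pow 2)).mono
      cube_subset_closedCube).aestronglyMeasurable measurableSet_cube
  · filter_upwards [ae_cube, hp'] with x hx hq
    have h1 : (sin (x j) / 2) ^ 2 ≤ omega x := by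
      refine (Finset.single_le_sum (f := fun j => (sin (x j) / 2) ^ 2)
        (fun i _ => sq_nonneg _) (Finset.mem_univ j)).trans ((sum_sin_sq_le x).trans ?_)
      have : 0 ≤ omega x ^ 2 / d := by positivity
      linarith
    rw [Real.norm_of_nonneg (by positivity), show omega x ^ p = omega x * omega x ^ (p - 1) by
      rw [← zpow_one_add₀ hx.2.ne']; ring_nf, ← mul_assoc]
    gcongr

lemma integrableOn_radialSq (hf : PeriodicC1 f) (h : 0 < (d : ℤ) + 2 * p) :
    IntegrableOn (fun x => radialSq f x * omega x ^ (p - 1)) (cube d) := by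
  have := integrable_finsetSum (Finset.univ : Finset (Fin d))
    fun j _ => integrableOn_radialSq_aux hf h j
  refine this.congr (Filter.Eventually.of_forall fun x => ?_)
  simp only [radialSq, Finset.mul_sum, Finset.sum_mul]

lemma weightedIntegral_radialSq_le (hf : PeriodicC1 f) (h : 0 < (d : ℤ) + 2 * p) :
    weightedIntegral (p - 1) (radialSq f) ≤ weightedIntegral p (fun x => ‖f x‖ ^ 2) -
      weightedIntegral (p + 1) (fun x => ‖f x‖ ^ 2) / d := by
  have h1 := integrableOn_mul_omega_zpow h hf.continuousOn_normSq
  have h2 := integrableOn_mul_omega_zpow (p := p + 1) (by omega) hf.continuousOn_normSq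
  unfold weightedIntegral
  rw [← integral_div, ← integral_sub h1 (h2.div_const _)]
  refine integral_mono_ae (integrableOn_radialSq hf h) (h1.sub (h2.div_const _)) ?_
  filter_upwards [ae_cube] with x hx
  have h3 := sum_sin_sq_le x
  have h4 : omega x ^ p = omega x ^ (p - 1) * omega x := by
    rw [← zpow_add_one₀ hx.2.ne']; ring_nf
  have h5 : omega x ^ (p + 1) = omega x ^ (p - 1) * omega x ^ 2 := by
    rw [zpow_add_one₀ hx.2.ne', h4]; ring
  rw [h4, h5, radialSq]
  have h6 : 0 ≤ ‖f x‖ ^ 2 * omega x ^ (p - 1) :=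
    mul_nonneg (sq_nonneg _) (zpow_nonneg hx.2.le _)
  calc _ = ‖f x‖ ^ 2 * omega x ^ (p - 1) * ∑ j, (sin (x j) / 2) ^ 2 := by ring
    _ ≤ ‖f x‖ ^ 2 * omega x ^ (p - 1) * (omega x - omega x ^ 2 / d) := by gcongr
    _ = _ := by ring

/-- Integration by parts of `|f|²` against the field `ω^p ∇ω`. -/
lemma two_mul_weightedIntegral_radialTerm (hf : PeriodicC1 f) (hp : p ≤ 0)
    (h : 0 < (d : ℤ) + 2 * p) :
    2 * weightedIntegral p (radialTerm f) =
      -(d / 2) * weightedIntegral p (fun x => ‖f x‖ ^ 2) +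
        weightedIntegral (p + 1) (fun x => ‖f x‖ ^ 2) -
        p * weightedIntegral (p - 1) (radialSq f) := by
  -- The components of the field `|f|² ∇ω`, whose divergence is `|f|² (d/2 - ω) + 2 Re(f̄ ∇f · ∇ω)`.
  let u : Fin d → EuclideanSpace ℝ (Fin d) → ℝ := fun j x => inner ℝ (f x) (f x) * (sin (x j) / 2)
  have hu : ∀ j, PeriodicC1 (u j) := fun j => (hf.inner hf).mul (periodicC1_sin j)
  have hpd : ∀ j, ∀ x ∈ closedCube d, pd j (u j) x =
      ‖f x‖ ^ 2 * (1 / 2 - sin (x j / 2) ^ 2) +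
        2 * (inner ℝ (f x) (pd j f x) * (sin (x j) / 2)) := by
    intro j x hx
    rw [pd_mul hx (hf.inner hf) (periodicC1_sin j), pd_inner hx hf hf, pd_sin j hx,
      real_inner_self_eq_norm_sq, real_inner_comm (pd j f x)]
    ring
  have hi1 : ∀ j, IntegrableOn (fun x => pd j (u j) x * omega x ^ p) (cube d) := fun j =>
    integrableOn_mul_omega_zpow h ((hu j).continuousOn_pd j)
  have hue : ∀ j x, u j x * (sin (x j) / 2) * omega x ^ (p - 1) =
      ‖f x‖ ^ 2 * (sin (x j) / 2) ^ 2 * omega x ^ (p - 1) := by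
    intro j x
    simp only [u, real_inner_self_eq_norm_sq]; ring
  have hi2 : ∀ j, IntegrableOn (fun x => u j x * (sin (x j) / 2) * omega x ^ (p - 1)) (cube d) := by
    intro j
    simp_rw [hue]
    exact integrableOn_radialSq_aux hf h j
  have key := Finset.sum_congr (rfl : (Finset.univ : Finset (Fin d)) = _)
    fun j _ => (hu j).integral_pd_mul_zpow j hp (hi1 j) (hi2 j)
  rw [← integral_finsetSum _ fun j _ => hi1 j, ← Finset.mul_sum,
    ← integral_finsetSum _ fun j _ => hi2 j] at key
  have e1 : ∫ x in cube d, ∑ j, u j x * (sin (x j) / 2) * omega x ^ (p - 1) =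
      weightedIntegral (p - 1) (radialSq f) := by
    unfold weightedIntegral
    congr 1
    ext x
    simp only [hue, radialSq, Finset.mul_sum, Finset.sum_mul]
  have hn := integrableOn_mul_omega_zpow h hf.continuousOn_normSq
  have hn1 := integrableOn_mul_omega_zpow (p := p + 1) (by omega) hf.continuousOn_normSq
  have hr := integrableOn_mul_omega_zpow h hf.continuousOn_radialTerm
  have e2 : ∫ x in cube d, ∑ j, pd j (u j) x * omega x ^ p =
      d / 2 * weightedIntegral p (fun x => ‖f x‖ ^ 2) -
        weightedIntegral (p + 1) (fun x => ‖f x‖ ^ 2) + 2 * weightedIntegral p (radialTerm f) := by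
    have hs : IntegrableOn (fun x => d / 2 * (‖f x‖ ^ 2 * omega x ^ p) -
      ‖f x‖ ^ 2 * omega x ^ (p + 1)) (cube d) := (hn.const_mul _).sub hn1
    unfold weightedIntegral
    rw [← integral_const_mul, ← integral_const_mul, ← integral_sub (hn.const_mul _) hn1,
      ← integral_add hs (hr.const_mul _)]
    refine integral_congr_ae ?_
    filter_upwards [ae_cube] with x hx
    rw [← Finset.sum_mul, Finset.sum_congr rfl fun j _ => hpd j x (cube_subset_closedCube hx.1),
      Finset.sum_add_distrib, ← Finset.mul_sum, sum_half_sub, ← Finset.mul_sum,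
      zpow_add_one₀ hx.2.ne', radialTerm]
    ring
  rw [e1, e2] at key
  linarith

/-- Young's inequality for the radial term. -/
lemma neg_two_mul_weightedIntegral_radialTerm_le (hf : PeriodicC1 f) (h : 0 < (d : ℤ) + 2 * p)
    {a : ℝ} (ha : 0 < a) :
    -2 * weightedIntegral p (radialTerm f) ≤
      2 / a * weightedIntegral (p + 1) (gradSq f) + a / 2 * weightedIntegral (p - 1) (radialSq f) := by
  have h1 := integrableOn_mul_omega_zpow (p := p + 1) (by omega) hf.continuousOn_gradSq
  have h2 := integrableOn_radialSq hf h
  have h3 := integrableOn_mul_omega_zpow h hf.continuousOn_radialTerm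
  unfold weightedIntegral
  rw [← integral_const_mul, ← integral_const_mul, ← integral_const_mul,
    ← integral_add (h1.const_mul _) (h2.const_mul _)]
  refine integral_mono_ae (h3.const_mul _) ((h1.const_mul _).add (h2.const_mul _)) ?_
  filter_upwards [ae_cube] with x hx
  have h4 : omega x ^ p = omega x ^ (p - 1) * omega x := by
    rw [← zpow_add_one₀ hx.2.ne']; ring_nf
  have h5 : omega x ^ (p + 1) = omega x ^ (p - 1) * omega x ^ 2 := by
    rw [zpow_add_one₀ hx.2.ne', h4]; ring
  have h6 : 0 ≤ omega x ^ (p - 1) := zpow_nonneg hx.2.le _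
  have h7 : -2 * radialTerm f x * omega x ≤
      2 / a * (gradSq f x * omega x ^ 2) + a / 2 * radialSq f x := by
    simp only [radialTerm, radialSq, gradSq, Finset.mul_sum, Finset.sum_mul]
    rw [← Finset.sum_add_distrib]
    refine Finset.sum_le_sum fun j _ => ?_
    have h8 := abs_real_inner_le_norm (f x) (pd j f x)
    change _ ≤ 2 / a * (‖pd j f x‖ ^ 2 * omega x ^ 2) + _
    set s := sin (x j) / 2
    set A := ‖f x‖
    set B := ‖pd j f x‖
    have h9 : -(inner ℝ (f x) (pd j f x) * s) ≤ A * B * |s| := by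
      refine (neg_le_abs _).trans ?_
      rw [abs_mul]
      gcongr
    have h10 : 2 / a * (B ^ 2 * omega x ^ 2) + a / 2 * (A ^ 2 * s ^ 2) - 2 * (A * B * |s|) * omega x =
        (2 * B * omega x - a * A * |s|) ^ 2 / (2 * a) := by
      rw [← sq_abs s]; field_simp; ring
    have h11 : 0 ≤ (2 * B * omega x - a * A * |s|) ^ 2 / (2 * a) := by positivity
    nlinarith [hx.2]
  rw [h4, h5]
  nlinarith

/-- One step of the weighted Hardy inequality. -/
theorem hardy_step (hf : PeriodicC1 f) {k : ℤ} (hk : k ≤ 0) (h : 0 < (d : ℤ) + 2 * k - 2) :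
    weightedIntegral (k - 1) (fun x => ‖f x‖ ^ 2) ≤
      hardyC1 k d * weightedIntegral k (gradSq f) +
        hardyC2 k d * weightedIntegral k (fun x => ‖f x‖ ^ 2) := by
  have hd : (0 : ℝ) < d := by exact_mod_cast Nat.pos_of_ne_zero (NeZero.ne d)
  have hD : (0 : ℝ) < d + 2 * k - 2 := by exact_mod_cast h
  have hk' : (k : ℝ) ≤ 0 := by exact_mod_cast hk
  have h0 : 0 < (d : ℤ) + 2 * (k - 1) := by omega
  have e1 := two_mul_weightedIntegral_radialTerm hf (p := k - 1) (by omega) h0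
  -- With a general parameter `a` the gradient coefficient becomes `4 / (a (D - a))`, where `D = d +
  -- 2k - 2`; the choice `a = D/2` minimises it and gives `16 / D²`.
  have e2 := neg_two_mul_weightedIntegral_radialTerm_le hf h0 (a := ((d : ℝ) + 2 * k - 2) / 2)
    (by linarith)
  have e3 := weightedIntegral_radialSq_le hf h0
  rw [sub_add_cancel] at e1 e2 e3
  push_cast at e1
  set I := weightedIntegral (k - 1) fun x => ‖f x‖ ^ 2
  set I' := weightedIntegral k fun x => ‖f x‖ ^ 2
  set G := weightedIntegral k (gradSq f)
  set N := weightedIntegral (k - 1 - 1) (radialSq f)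
  set D : ℝ := (d : ℝ) + 2 * k - 2 with hDdef
  have e4 : (D / 2 / 2 + 1 - k) * N ≤ (D / 2 / 2 + 1 - k) * (I - I' / d) := by
    refine mul_le_mul_of_nonneg_left e3 (by linarith)
  have e5 : D / 4 * I ≤ 4 / D * G + (1 - (D / 4 + 1 - k) / d) * I' := by
    have : 2 / (D / 2) = 4 / D := by field_simp; norm_num
    rw [this] at e2
    have h6 : (D / 2 / 2 + 1 - k) * (I - I' / d) =
        (d / 2 - D / 4) * I - (D / 4 + 1 - k) / d * I' := by
      rw [hDdef]; field_simp; ring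
    linarith
  have e6 : I ≤ 4 / D * (4 / D * G + (1 - (D / 4 + 1 - k) / d) * I') := by
    have := mul_le_mul_of_nonneg_left e5 (by positivity : 0 ≤ 4 / D)
    calc I = 4 / D * (D / 4 * I) := by field_simp
      _ ≤ _ := this
  refine e6.trans (le_of_eq ?_)
  unfold hardyC1 hardyC2
  rw [← hDdef, mul_add, ← mul_assoc, ← mul_assoc]
  congr 2
  · field_simp; norm_num
  · field_simp
    rw [hDdef]; ring

end FirstOrder

/-! ### Second order identities and the Rellich step. -/

section SecondOrder

variable [NeZero d] {f : EuclideanSpace ℝ (Fin d) → ℂ} {p : ℤ}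

/-- The Laplacian of a function on the closed cube. -/
noncomputable abbrev lap (f : EuclideanSpace ℝ (Fin d) → ℂ) : EuclideanSpace ℝ (Fin d) → ℂ :=
  InnerProductSpace.laplacianWithin f (closedCube d)

/-- Integration by parts of `|∇f|²` against `ω^p`. -/
lemma weightedIntegral_gradSq_add (hf : SmoothPeriodic f) (hp : p ≤ 0)
    (h : 0 < (d : ℤ) + 2 * p - 2) :
    weightedIntegral p (gradSq f) + weightedIntegral p (fun x => inner ℝ (f x) (lap f x)) =
      -p * weightedIntegral (p - 1) (radialTerm f) := by
  have h0 : 0 < (d : ℤ) + 2 * p := by omega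
  have h1 : 0 < (d : ℤ) + 2 * (p - 1) := by omega
  have hf1 := hf.periodicC1
  have hfj := fun j => (hf.pd j).periodicC1
  have hi1 : ∀ j, IntegrableOn (fun x =>
      pd j (fun y => inner ℝ (f y) (pd j f y)) x * omega x ^ p) (cube d) := fun j =>
    integrableOn_mul_omega_zpow h0 ((hf1.inner (hfj j)).continuousOn_pd j)
  have hi2 : ∀ j, IntegrableOn (fun x =>
      inner ℝ (f x) (pd j f x) * (sin (x j) / 2) * omega x ^ (p - 1)) (cube d) := fun j =>
    integrableOn_mul_omega_zpow h1
      ((hf1.inner (hfj j)).continuousOn.mul (periodicC1_sin j).continuousOn)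
  have key := Finset.sum_congr (rfl : (Finset.univ : Finset (Fin d)) = _)
    fun j _ => (hf1.inner (hfj j)).integral_pd_mul_zpow j hp (hi1 j) (hi2 j)
  rw [← integral_finsetSum _ fun j _ => hi1 j, ← Finset.mul_sum,
    ← integral_finsetSum _ fun j _ => hi2 j] at key
  have e1 : ∫ x in cube d, ∑ j, inner ℝ (f x) (pd j f x) * (sin (x j) / 2) * omega x ^ (p - 1) =
      weightedIntegral (p - 1) (radialTerm f) := by
    unfold weightedIntegral
    simp only [radialTerm, Finset.sum_mul]
  rw [e1] at key
  rw [← key]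
  unfold weightedIntegral
  rw [← integral_add (integrableOn_mul_omega_zpow h0 hf1.continuousOn_gradSq)
    (integrableOn_mul_omega_zpow h0
      (hf1.continuousOn.inner hf.laplacianWithin.periodicC1.continuousOn))]
  refine setIntegral_congr_fun measurableSet_cube fun x hx => ?_
  have hx' := cube_subset_closedCube hx
  rw [← Finset.sum_mul, Finset.sum_congr rfl fun j _ => pd_inner hx' hf1 (hfj j) j,
    Finset.sum_add_distrib, laplacianWithin_eq_sum_pd hf hx', inner_sum, ← add_mul, add_comm]
  congr 2
  exact Finset.sum_congr rfl fun j _ => (real_inner_self_eq_norm_sq _).symm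

/-- Young's inequality for the pairing of `f` with its Laplacian. -/
lemma neg_weightedIntegral_inner_lap_le (hf : SmoothPeriodic f) (h : 0 < (d : ℤ) + 2 * p - 2)
    {a : ℝ} (ha : 0 < a) :
    -weightedIntegral p (fun x => inner ℝ (f x) (lap f x)) ≤
      1 / (2 * a) * weightedIntegral (p + 1) (fun x => ‖lap f x‖ ^ 2) +
        a / 2 * weightedIntegral (p - 1) (fun x => ‖f x‖ ^ 2) := by
  have hf1 := hf.periodicC1
  have hl := hf.laplacianWithin.periodicC1
  have h1 := integrableOn_mul_omega_zpow (p := p + 1) (by omega) hl.continuousOn_normSq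
  have h2 := integrableOn_mul_omega_zpow (p := p - 1) (by omega) hf1.continuousOn_normSq
  have h3 := integrableOn_mul_omega_zpow (p := p) (by omega) (hf1.continuousOn.inner (𝕜 := ℝ) hl.continuousOn)
  unfold weightedIntegral
  rw [← integral_const_mul, ← integral_const_mul, ← integral_neg,
    ← integral_add (h1.const_mul _) (h2.const_mul _)]
  refine integral_mono_ae h3.neg ((h1.const_mul _).add (h2.const_mul _)) ?_
  filter_upwards [ae_cube] with x hx
  have h4 : omega x ^ p = omega x ^ (p - 1) * omega x := by
    rw [← zpow_add_one₀ hx.2.ne']; ring_nf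
  have h5 : omega x ^ (p + 1) = omega x ^ (p - 1) * omega x ^ 2 := by
    rw [zpow_add_one₀ hx.2.ne', h4]; ring
  have h6 : 0 ≤ omega x ^ (p - 1) := zpow_nonneg hx.2.le _
  have h8 := (neg_le_abs _).trans (abs_real_inner_le_norm (f x) (lap f x))
  set A := ‖f x‖
  set B := ‖lap f x‖
  have h10 : 1 / (2 * a) * (B ^ 2 * omega x ^ 2) + a / 2 * A ^ 2 - A * B * omega x =
      (B * omega x - a * A) ^ 2 / (2 * a) := by
    field_simp; ring
  have h11 : 0 ≤ (B * omega x - a * A) ^ 2 / (2 * a) := by positivity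
  have h12 : -inner ℝ (f x) (lap f x) * omega x ≤
      1 / (2 * a) * (B ^ 2 * omega x ^ 2) + a / 2 * A ^ 2 := by
    nlinarith [hx.2]
  rw [h4, h5]
  nlinarith

/-- The square root of the leading constant of the Rellich inequality. -/
noncomputable def rellichM (k : ℤ) (d : ℕ) : ℝ := ((d : ℝ) + 2 * k - 4) * (d - 2 * k) / 16

/-- The coefficient of the lower order term of the Rellich inequality. -/
noncomputable def rellichE (k : ℤ) (d : ℕ) : ℝ :=
  ((3 * (d : ℝ) + 2 * k - 4) * (d + 2 * k - 4) + 8 * (1 - k) * (d + k - 2)) / (16 * d)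

/-- The weighted Rellich inequality with a lower order term. -/
theorem rellich_step (hf : SmoothPeriodic f) {k : ℤ} (hk : k ≤ 0) (h : 0 < (d : ℤ) + 2 * k - 4) :
    rellichM k d ^ 2 * weightedIntegral (k - 2) (fun x => ‖f x‖ ^ 2) ≤
      weightedIntegral k (fun x => ‖lap f x‖ ^ 2) +
        2 * rellichM k d * rellichE k d * weightedIntegral (k - 1) (fun x => ‖f x‖ ^ 2) := by
  have hd : (0 : ℝ) < d := by exact_mod_cast Nat.pos_of_ne_zero (NeZero.ne d)
  have hD : (0 : ℝ) < d + 2 * k - 4 := by exact_mod_cast h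
  have hk' : (k : ℝ) ≤ 0 := by exact_mod_cast hk
  have hM : 0 < rellichM k d := by
    unfold rellichM
    have : (0 : ℝ) < d - 2 * k := by linarith
    positivity
  have hf1 := hf.periodicC1
  have e1 := weightedIntegral_gradSq_add hf (p := k - 1) (by omega) (by omega)
  have e2 := two_mul_weightedIntegral_radialTerm hf1 (p := k - 1 - 1) (by omega) (by omega)
  have e3 := weightedIntegral_radialSq_le hf1 (p := k - 1 - 1) (by omega)
  -- With Young parameter `a` the leading constant would be `a (2M - a)`, where `M = rellichM k d`;
  -- it is largest at `a = M`.
  have e4 := neg_weightedIntegral_inner_lap_le hf (p := k - 1) (by omega) hM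
  have e5 := hardy_step hf1 (k := k - 1) (by omega) (by omega)
  have hk2 : k - 2 = k - 1 - 1 := by ring
  rw [hk2]
  simp only [sub_add_cancel] at e1 e2 e3 e4 e5
  push_cast at e1 e2
  unfold hardyC1 hardyC2 at e5
  push_cast at e5
  set I := weightedIntegral (k - 1 - 1) fun x => ‖f x‖ ^ 2
  set I' := weightedIntegral (k - 1) fun x => ‖f x‖ ^ 2
  set G := weightedIntegral (k - 1) (gradSq f)
  set L := weightedIntegral k fun x => ‖lap f x‖ ^ 2
  set N := weightedIntegral (k - 1 - 1 - 1) (radialSq f)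
  set X := weightedIntegral (k - 1 - 1) (radialTerm f)
  set D : ℝ := (d : ℝ) + 2 * k - 4 with hDdef
  have hG : D ^ 2 / 16 * I ≤ G + (3 * d + 2 * k - 4) * D / (16 * d) * I' := by
    have h1 : (d : ℝ) + 2 * (k - 1) - 2 = D := by rw [hDdef]; ring
    have h2 : 3 * (d : ℝ) + 2 * (k - 1) - 2 = 3 * d + 2 * k - 4 := by ring
    rw [h1, h2] at e5
    have := mul_le_mul_of_nonneg_left e5 (by positivity : 0 ≤ D ^ 2 / 16)
    refine this.trans (le_of_eq ?_)
    field_simp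
  have hX : X ≤ -(D / 4) * I + (1 - (2 - k) / d) / 2 * I' := by
    have h1 : (2 - k) * N ≤ (2 - k) * (I - I' / d) :=
      mul_le_mul_of_nonneg_left e3 (by linarith)
    have h2 : (2 - k) * (I - I' / d) = (2 - k) * I - (2 - k) / d * I' := by ring
    rw [hDdef]
    nlinarith
  have hX' := mul_le_mul_of_nonneg_left hX (by linarith : 0 ≤ 1 - (k : ℝ))
  have hMI : rellichM k d * I ≤
      1 / (2 * rellichM k d) * L + rellichM k d / 2 * I + rellichE k d * I' := by
    -- The two sources of the leading coefficient: `D²/16` from the Hardy step at `k - 1`, and `(1 -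
    -- k) D/4` from the radial term.
    have h1 : rellichM k d * I = D ^ 2 / 16 * I + (1 - k) * (D / 4) * I := by
      unfold rellichM; rw [← hDdef]; ring_nf
      rw [hDdef]; ring
    have h2 : rellichE k d * I' = (3 * d + 2 * k - 4) * D / (16 * d) * I' +
        (1 - k) * ((1 - (2 - k) / d) / 2 * I') := by
      unfold rellichE; rw [← hDdef]; field_simp; ring
    rw [h1, h2]
    linarith
  have hMI' := mul_le_mul_of_nonneg_left hMI (by positivity : 0 ≤ 2 * rellichM k d)
  have h3 : 2 * rellichM k d * (1 / (2 * rellichM k d) * L) = L := by field_simp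
  nlinarith

end SecondOrder

end

/-! ### Algebra of the constants. -/

section

variable {d : ℕ}

section Constants

lemma constSum_zero (C₁ C₂ : ℤ → ℕ → ℝ) (d : ℕ) : constSum C₁ C₂ 0 d = C₁ 0 d + C₂ 0 d := by
  simp [constSum]

/-- Splits off the `j = 0` term and the `i = 0` factor of each product. This is the form in which
the induction on `k` meets the constant. -/
lemma constSum_of_neg (C₁ C₂ : ℤ → ℕ → ℝ) {k : ℤ} (hk : k < 0) (d : ℕ) :
    constSum C₁ C₂ k d = C₁ k d + d * C₂ k d * constSum C₁ C₂ (k + 1) d := by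
  obtain ⟨n, rfl⟩ : ∃ n : ℕ, k = -(n + 1) := ⟨(-k - 1).toNat, by omega⟩
  have h1 : (-(-((n : ℤ) + 1))).toNat = n + 1 := by omega
  have h2 : (-(-((n : ℤ) + 1) + 1)).toNat = n := by omega
  have h3 : ∀ i : ℕ, -((n : ℤ) + 1) + ((i + 1 : ℕ) : ℤ) = -((n : ℤ) + 1) + 1 + i := by
    intro i; push_cast; ring
  unfold constSum
  rw [h1, h2, Finset.sum_range_succ']
  simp only [Finset.prod_range_succ' _ (_ + 1), Finset.prod_range_succ', h3]
  simp only [pow_succ, Nat.cast_zero, add_zero, Finset.range_zero, Finset.prod_empty, mul_one,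
    pow_zero, one_mul, mul_add, Finset.mul_sum]
  have h4 : ∀ i ∈ Finset.range (n + 1), (d : ℝ) ^ i * d * C₁ (-((n : ℤ) + 1) + 1 + i) d *
      ((∏ j ∈ Finset.range i, C₂ (-((n : ℤ) + 1) + 1 + j) d) * C₂ (-((n : ℤ) + 1)) d) =
      d * C₂ (-((n : ℤ) + 1)) d * ((d : ℝ) ^ i * C₁ (-((n : ℤ) + 1) + 1 + i) d *
        ∏ j ∈ Finset.range i, C₂ (-((n : ℤ) + 1) + 1 + j) d) := by
    intro i _; ring
  rw [Finset.sum_congr rfl h4]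
  ring

variable {k : ℤ}

lemma hardyC1_nonneg : 0 ≤ hardyC1 k d := by unfold hardyC1; positivity

lemma hardyC2_nonneg (h : 0 < (d : ℤ) + 2 * k - 2) : 0 ≤ hardyC2 k d := by
  have hD : (0 : ℝ) < d + 2 * k - 2 := by exact_mod_cast h
  have hd : (0 : ℝ) ≤ d := Nat.cast_nonneg d
  unfold hardyC2
  exact div_nonneg (by linarith) (mul_nonneg hd hD.le)

lemma hardy_constSum_nonneg (h : 0 < (d : ℤ) + 2 * k - 2) :
    0 ≤ constSum hardyC1 hardyC2 k d :=
  add_nonneg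
    (Finset.sum_nonneg fun j _ => mul_nonneg (mul_nonneg (by positivity) hardyC1_nonneg)
      (Finset.prod_nonneg fun i _ => hardyC2_nonneg (by omega)))
    (mul_nonneg (by positivity) (Finset.prod_nonneg fun i _ => hardyC2_nonneg (by omega)))

lemma hardy_constSum_pos (hk : k ≤ 0) (h : 0 < (d : ℤ) + 2 * k - 2) :
    0 < constSum hardyC1 hardyC2 k d := by
  have hD : (0 : ℝ) < d + 2 * k - 2 := by exact_mod_cast h
  have h1 : 0 < hardyC1 k d := by unfold hardyC1; positivity
  have h2 := hardyC2_nonneg h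
  rcases hk.lt_or_eq with hk | rfl
  · rw [constSum_of_neg _ _ hk]
    have h3 := hardy_constSum_nonneg (d := d) (k := k + 1) (by omega)
    positivity
  · rw [constSum_zero]; positivity

/-- At `k = 0` the product equals `3 + 20/d`. Each step of the recursion multiplies it by `d *
hardyRellichC2 ≥ 1` and adds a nonnegative term. -/
lemma three_le_mul_hardyRellich_constSum [NeZero d] (hk : k ≤ 0) :
    3 ≤ d * constSum hardyRellichC1 hardyRellichC2 k d := by
  have hd : (0 : ℝ) < d := by exact_mod_cast Nat.pos_of_ne_zero (NeZero.ne d)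
  obtain ⟨n, rfl⟩ : ∃ n : ℕ, k = -n := ⟨(-k).toNat, by omega⟩
  clear hk
  induction n with
  | zero =>
    have h1 : (d : ℝ) * constSum hardyRellichC1 hardyRellichC2 (-((0 : ℕ) : ℤ)) d = 3 + 20 / d := by
      rw [show (-((0 : ℕ) : ℤ)) = 0 by simp, constSum_zero]
      unfold hardyRellichC1 hardyRellichC2
      simp only [Int.cast_zero, mul_zero, sub_zero]
      field_simp
      ring
    rw [h1]
    have : 0 < 20 / (d : ℝ) := by positivity
    linarith
  | succ n ih =>
    rw [constSum_of_neg _ _ (by omega),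
      show -((n + 1 : ℕ) : ℤ) + 1 = -(n : ℤ) by push_cast; ring, mul_add]
    have hB1 : 0 ≤ d * hardyRellichC1 (-((n + 1 : ℕ) : ℤ)) d := by
      unfold hardyRellichC1; positivity
    have hB2 : 1 ≤ d * hardyRellichC2 (-((n + 1 : ℕ) : ℤ)) d := by
      unfold hardyRellichC2
      push_cast
      have h2 : (0 : ℝ) < d - 2 * (-1 + -n) := by have : (0 : ℝ) ≤ n := n.cast_nonneg; linarith
      rw [show -((n : ℝ) + 1) = -1 + -n by ring]
      rw [mul_div_assoc', mul_div_mul_left _ _ hd.ne', le_div_iff₀ h2]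
      linarith
    nlinarith

lemma rellichM_pos (hk : k ≤ 0) (h : 0 < (d : ℤ) + 2 * k - 4) : 0 < rellichM k d := by
  have hD : (0 : ℝ) < d + 2 * k - 4 := by exact_mod_cast h
  have hk' : (k : ℝ) ≤ 0 := by exact_mod_cast hk
  have : (0 : ℝ) < d - 2 * k := by linarith
  unfold rellichM
  positivity

lemma rellichE_nonneg (hk : k ≤ 0) (h : 0 < (d : ℤ) + 2 * k - 4) : 0 ≤ rellichE k d := by
  have hD : (0 : ℝ) < d + 2 * k - 4 := by exact_mod_cast h
  have hk' : (k : ℝ) ≤ 0 := by exact_mod_cast hk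
  have hd : (0 : ℝ) ≤ d := d.cast_nonneg
  unfold rellichE
  refine div_nonneg (add_nonneg (mul_nonneg (by linarith) hD.le)
    (mul_nonneg (by linarith) (by linarith))) (by linarith)

/-- The recursive inequality between the constants that propagates the bound of the lower order
term of the Rellich inequality. -/
lemma rellich_const_step (hk : k < 0) (h : 0 < (d : ℤ) + 2 * k - 4) :
    d * (1 + rellichM (k + 1) d * rellichE (k + 1) d *
        (d * constSum hardyRellichC1 hardyRellichC2 (k + 1) d *
          constSum hardyC1 hardyC2 (k + 1) d)) ≤
      rellichM (k + 1) d ^ 2 * (1 / 2 * (d * constSum hardyRellichC1 hardyRellichC2 k d *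
        constSum hardyC1 hardyC2 k d)) := by
  have hd0 : NeZero d := ⟨by omega⟩
  have hD : (0 : ℝ) < d + 2 * k - 4 := by exact_mod_cast h
  have hk' : (k : ℝ) ≤ -1 := by exact_mod_cast (by omega : k ≤ -1)
  have hd : (0 : ℝ) < d := by linarith
  have hT := three_le_mul_hardyRellich_constSum (d := d) (k := k + 1) (by omega)
  have hS := hardy_constSum_nonneg (d := d) (k := k + 1) (by omega)
  rw [constSum_of_neg hardyC1 hardyC2 hk, constSum_of_neg hardyRellichC1 hardyRellichC2 hk]
  set T' := constSum hardyRellichC1 hardyRellichC2 (k + 1) d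
  set S' := constSum hardyC1 hardyC2 (k + 1) d
  have hA1 : 0 ≤ hardyC1 k d := hardyC1_nonneg
  have hA2 : 0 ≤ hardyC2 k d := hardyC2_nonneg (by omega)
  have hB1 : 0 ≤ hardyRellichC1 k d := by unfold hardyRellichC1; positivity
  have hD' : (0 : ℝ) < d + 2 * k - 2 := by linarith
  have hR : (0 : ℝ) < d - 2 * k := by linarith
  have hT0 : 0 ≤ constSum hardyRellichC1 hardyRellichC2 (k + 1) d := by
    by_contra! hneg; nlinarith
  have hM := rellichM_pos (d := d) (k := k + 1) (by omega) (by omega)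
  -- In the variables `s ≥ 0` and `t > 0`, with `k = -1 - s` and `d = t + 2s + 6`, the admissible
  -- range becomes a quadrant on which the polynomial differences below are visibly nonnegative
  -- after expansion.
  obtain ⟨s, hs⟩ : ∃ s : ℝ, s = -1 - k := ⟨_, rfl⟩
  obtain ⟨t, ht⟩ : ∃ t : ℝ, t = d + 2 * k - 4 := ⟨_, rfl⟩
  have hs0 : 0 ≤ s := by linarith
  have ht0 : 0 < t := by linarith
  have hks : (k : ℝ) = -1 - s := by linarith
  have hdt : (d : ℝ) = t + 2 * s + 6 := by linarith
  -- Expanding both recursions on the right side, the product of their recursive parts absorbs the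
  -- term with `E`.
  have hi : 2 * rellichE (k + 1) d ≤
      d * hardyRellichC2 k d * hardyC2 k d * rellichM (k + 1) d := by
    have h1 : (d : ℝ) * hardyRellichC2 k d * hardyC2 k d * rellichM (k + 1) d =
        (3 * d - 2 * k + 4) * (3 * d + 2 * k - 2) * (d - 2 * k - 2) / (16 * d * (d - 2 * k)) := by
      unfold hardyRellichC2 hardyC2 rellichM
      push_cast
      rw [show (d : ℝ) + 2 * (k + 1) - 4 = d + 2 * k - 2 by ring]
      field_simp
      ring
    rw [h1]
    unfold rellichE
    push_cast
    rw [mul_div_assoc', div_le_div_iff₀ (by positivity) (by positivity), ← sub_nonneg, hks, hdt]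
    ring_nf
    positivity
  -- The recursive part of the Hardy-Rellich sum times `hardyC1` absorbs the term `1`; the factor
  -- `3` stands for the lower bound on `d * T'`.
  have hii : 2 ≤ hardyRellichC2 k d * 3 * hardyC1 k d * rellichM (k + 1) d ^ 2 := by
    have h1 : hardyRellichC2 k d * 3 * hardyC1 k d * rellichM (k + 1) d ^ 2 =
        3 * (3 * d - 2 * k + 4) * (d - 2 * k - 2) ^ 2 / (16 * d * (d - 2 * k)) := by
      unfold hardyRellichC2 hardyC1 rellichM
      push_cast
      rw [show (d : ℝ) + 2 * (k + 1) - 4 = d + 2 * k - 2 by ring]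
      field_simp
      ring
    rw [h1, le_div_iff₀ (by positivity), ← sub_nonneg, hks, hdt]
    ring_nf
    positivity
  have hB2 : 0 ≤ hardyRellichC2 k d := by
    unfold hardyRellichC2
    exact div_nonneg (by linarith) (by positivity)
  set M := rellichM (k + 1) d
  set E := rellichE (k + 1) d
  have g1 : 2 * E * (M * (d * T' * S') * d) ≤
      d * hardyRellichC2 k d * hardyC2 k d * M * (M * (d * T' * S') * d) :=
    mul_le_mul_of_nonneg_right hi (by positivity)
  have g2 : hardyRellichC2 k d * 3 * hardyC1 k d * M ^ 2 ≤
      hardyRellichC2 k d * (d * T') * hardyC1 k d * M ^ 2 := by gcongr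
  have g3 : 2 * (d : ℝ) ≤ hardyRellichC2 k d * (d * T') * hardyC1 k d * M ^ 2 * d :=
    mul_le_mul_of_nonneg_right (hii.trans g2) hd.le
  -- The contributions of `hardyRellichC1` are superfluous and are only kept nonnegative.
  have g4 : 0 ≤ M ^ 2 * (d * hardyRellichC1 k d * (hardyC1 k d + d * hardyC2 k d * S')) := by
    positivity
  linarith

/-- With `u = d - 2` and `v = 2(1 - k)` the radicand is `2(u² + v²)`, which lies between `(u + v)²`
and `(9/4)(u + v)²`. The lower bound serves `rellichC2`, both serve the sign of `rellichC1`. -/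
lemma rellichBeta_bounds (hk : k ≤ 0) (h : 0 < (d : ℤ) + 2 * k - 4) :
    ((d : ℝ) + 2 * k - 4) / 8 ≤ rellichBeta ((k : ℝ) / 2) d ∧
      rellichBeta ((k : ℝ) / 2) d ≤ 3 / 16 * (d - 2) := by
  have hD : (0 : ℝ) < d + 2 * k - 4 := by exact_mod_cast h
  have hk' : (k : ℝ) ≤ 0 := by exact_mod_cast hk
  unfold rellichBeta
  rw [← Real.sqrt_mul (by norm_num)]
  have h1 : (d : ℝ) - 2 + 2 * (1 - k) ≤ √(2 * ((d : ℝ) ^ 2 - 4 * d + 16 * ((k : ℝ) / 2) ^ 2 -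
      16 * ((k : ℝ) / 2) + 8)) := by
    apply Real.le_sqrt_of_sq_le
    nlinarith [sq_nonneg ((d : ℝ) - 2 - 2 * (1 - k))]
  have h2 : √(2 * ((d : ℝ) ^ 2 - 4 * d + 16 * ((k : ℝ) / 2) ^ 2 -
      16 * ((k : ℝ) / 2) + 8)) ≤ 3 / 2 * ((d : ℝ) - 2 + 2 * (1 - k)) := by
    apply Real.sqrt_le_iff.2 ⟨by linarith, ?_⟩
    nlinarith [sq_nonneg ((d : ℝ) - 2), mul_nonneg (by linarith : (0 : ℝ) ≤ d - 2)
      (by linarith : (0 : ℝ) ≤ 1 - k), sq_nonneg (1 - (k : ℝ))]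
  constructor <;> linarith

lemma rellichC1_nonneg (hk : k ≤ 0) (h : 0 < (d : ℤ) + 2 * k - 4) :
    0 ≤ rellichC1 ((k : ℝ) / 2) d := by
  have hD : (0 : ℝ) < d + 2 * k - 4 := by exact_mod_cast h
  have hk' : (k : ℝ) ≤ 0 := by exact_mod_cast hk
  obtain ⟨h1, h2⟩ := rellichBeta_bounds hk h
  unfold rellichC1
  refine div_nonneg (mul_nonneg (by linarith) (by linarith)) d.cast_nonneg

/-- Every factor of `rellichC2` containing `β` increases with `β`, so `β` may be replaced by its
lower bound `D/8`, where `D = d + 2k - 4`. What remains is a polynomial inequality whose difference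
factors into nonnegative terms. -/
lemma rellichM_mul_rellichE_le (hk : k ≤ 0) (h : 0 < (d : ℤ) + 2 * k - 4) :
    rellichM k d * rellichE k d ≤ rellichC2 ((k : ℝ) / 2) d := by
  have hD : (0 : ℝ) < d + 2 * k - 4 := by exact_mod_cast h
  have hk' : (k : ℝ) ≤ 0 := by exact_mod_cast hk
  have hd : (0 : ℝ) < d := by linarith
  obtain ⟨h1, -⟩ := rellichBeta_bounds hk h
  unfold rellichC2
  set β := rellichBeta ((k : ℝ) / 2) d
  set D : ℝ := (d : ℝ) + 2 * k - 4 with hDd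
  have h3 : D / 8 * (d - 2 * k) * (d + k - 2) * (D / 4 - k + 1) ≤
      β * (d + 4 * β - 4 * (k / 2)) * (d + 2 * (k / 2) - 2) * (2 * β - 2 * (k / 2) + 1) := by
    have : (0 : ℝ) ≤ d + k - 2 := by linarith
    have : (0 : ℝ) ≤ d - 2 * k := by linarith
    have : 0 ≤ D / 4 - k + 1 := by linarith
    have hβ : 0 < β := by linarith
    refine mul_le_mul (mul_le_mul (mul_le_mul h1 (by linarith) (by linarith) hβ.le) (by linarith)
      (by linarith) ?_) (by linarith) (by linarith) ?_
    · exact mul_nonneg hβ.le (by linarith)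
    · exact mul_nonneg (mul_nonneg hβ.le (by linarith)) (by linarith)
  refine le_trans ?_ (div_le_div_of_nonneg_right h3 (by positivity))
  unfold rellichM rellichE
  rw [← hDd, div_mul_div_comm, div_le_div_iff₀ (by positivity) (by positivity)]
  have h4 : 0 ≤ D * (d - 2 * k) * (D * D + 8 * (1 - k) * (d + k - 2)) := by
    have : (0 : ℝ) ≤ d + k - 2 := by linarith
    have : (0 : ℝ) ≤ d - 2 * k := by linarith
    have : (0 : ℝ) ≤ 1 - k := by linarith
    positivity
  have h5 : D / 8 * (d - 2 * k) * (d + k - 2) * (D / 4 - k + 1) * (16 * (16 * d)) -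
      D * (d - 2 * k) * ((3 * d + 2 * k - 4) * D + 8 * (1 - k) * (d + k - 2)) * (2 * d) =
      2 * d * (D * (d - 2 * k) * (D * D + 8 * (1 - k) * (d + k - 2))) := by
    rw [hDd]; ring
  nlinarith [mul_nonneg (by positivity : 0 ≤ 2 * (d : ℝ)) h4]

end Constants

end

/-! ### The weighted Hardy and Rellich inequalities and their iteration. -/

section

variable {d : ℕ} {f : EuclideanSpace ℝ (Fin d) → ℂ} {k : ℤ}

lemma poincare_weightedIntegral (hf : PeriodicC1 f) (h0 : ∫ x in cube d, f x = 0) :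
    weightedIntegral 0 (fun x => ‖f x‖ ^ 2) ≤ weightedIntegral 0 (gradSq f) := by
  have := poincare hf h0
  simpa [weightedIntegral, gradSq, pd] using this

variable [NeZero d]

/-- The weighted Hardy inequality. -/
theorem weighted_hardy (hf : PeriodicC1 f) (h0 : ∫ x in cube d, f x = 0) (hk : k ≤ 0)
    (h : 0 < (d : ℤ) + 2 * k - 2) :
    weightedIntegral (k - 1) (fun x => ‖f x‖ ^ 2) ≤
      constSum hardyC1 hardyC2 k d * weightedIntegral k (gradSq f) := by
  obtain ⟨n, rfl⟩ : ∃ n : ℕ, k = -n := ⟨(-k).toNat, by omega⟩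
  clear hk
  induction n with
  | zero =>
    have h1 := hardy_step hf (k := 0) le_rfl (by simpa using h)
    have h2 := mul_le_mul_of_nonneg_left (poincare_weightedIntegral hf h0)
      (hardyC2_nonneg (d := d) (k := 0) (by simpa using h))
    simp only [Nat.cast_zero, neg_zero]
    rw [constSum_zero, add_mul]
    linarith
  | succ n ih =>
    have hs := hardy_step hf (k := -((n + 1 : ℕ) : ℤ)) (by omega) h
    have e : -((n + 1 : ℕ) : ℤ) + 1 = -(n : ℤ) := by push_cast; ring
    have ih' := ih (by push_cast at h; omega)
    -- The hypothesis at `k + 1` bounds `∫ |f|² ω^k`, which is precisely the remainder of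
    -- `hardy_step` at `k`.
    rw [← e, add_sub_cancel_right] at ih'
    rw [constSum_of_neg _ _ (by omega)]
    set k : ℤ := -((n + 1 : ℕ) : ℤ)
    have hk : k < 0 := by omega
    have h1 := weightedIntegral_succ_le (p := k) (by omega) hf.continuousOn_gradSq (gradSq_nonneg f)
    have hS := hardy_constSum_nonneg (d := d) (k := k + 1) (by omega)
    have hA2 := hardyC2_nonneg (d := d) (k := k) h
    calc _ ≤ _ := hs
      _ ≤ hardyC1 k d * weightedIntegral k (gradSq f) + hardyC2 k d *
          (constSum hardyC1 hardyC2 (k + 1) d * (d * weightedIntegral k (gradSq f))) := by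
        gcongr
        exact ih'.trans (mul_le_mul_of_nonneg_left h1 hS)
      _ = _ := by ring

/-- The gradient is controlled by the Laplacian in the unweighted norm. -/
lemma weightedIntegral_zero_gradSq_le (hf : SmoothPeriodic f) (h0 : ∫ x in cube d, f x = 0)
    (h : 0 < (d : ℤ) - 2) :
    weightedIntegral 0 (gradSq f) ≤ weightedIntegral 0 (fun x => ‖lap f x‖ ^ 2) := by
  have hf1 := hf.periodicC1
  have hl := hf.laplacianWithin.periodicC1
  have h1 := weightedIntegral_gradSq_add hf (p := 0) le_rfl (by omega)
  have h2 := poincare_weightedIntegral hf1 h0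
  have i1 := integrableOn_mul_omega_zpow (p := 0) (by omega) hl.continuousOn_normSq
  have i2 := integrableOn_mul_omega_zpow (p := 0) (by omega) hf1.continuousOn_normSq
  have i3 := integrableOn_mul_omega_zpow (p := 0) (by omega)
    (hf1.continuousOn.inner (𝕜 := ℝ) hl.continuousOn)
  -- Half of `∫ |f|²` is bounded by half of the gradient integral through Poincaré and absorbed on
  -- the left, leaving constant `1`.
  have h3 : -weightedIntegral 0 (fun x => inner ℝ (f x) (lap f x)) ≤
      1 / 2 * weightedIntegral 0 (fun x => ‖lap f x‖ ^ 2) +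
        1 / 2 * weightedIntegral 0 (fun x => ‖f x‖ ^ 2) := by
    unfold weightedIntegral
    rw [← integral_const_mul, ← integral_const_mul, ← integral_neg,
      ← integral_add (i1.const_mul _) (i2.const_mul _)]
    refine integral_mono i3.neg ((i1.const_mul _).add (i2.const_mul _)) fun x => ?_
    have h8 := (neg_le_abs _).trans (abs_real_inner_le_norm (f x) (lap f x))
    simp only [zpow_zero, mul_one]
    nlinarith [sq_nonneg (‖f x‖ - ‖lap f x‖)]
  simp only [Int.cast_zero, neg_zero, zero_mul] at h1
  linarith

/-- The lower order term of the Rellich inequality is controlled by the Laplacian. -/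
theorem weightedIntegral_lower_order_le (hf : SmoothPeriodic f) (h0 : ∫ x in cube d, f x = 0)
    (hk : k ≤ 0) (h : 0 < (d : ℤ) + 2 * k - 4) :
    weightedIntegral (k - 1) (fun x => ‖f x‖ ^ 2) ≤
      1 / 2 * (d * constSum hardyRellichC1 hardyRellichC2 k d * constSum hardyC1 hardyC2 k d) *
        weightedIntegral k (fun x => ‖lap f x‖ ^ 2) := by
  have hL : ∀ p, 0 ≤ weightedIntegral p (fun x => ‖lap f x‖ ^ 2) := fun p =>
    weightedIntegral_nonneg p fun x => sq_nonneg _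
  obtain ⟨n, rfl⟩ : ∃ n : ℕ, k = -n := ⟨(-k).toNat, by omega⟩
  clear hk
  induction n with
  | zero =>
    have h1 := weighted_hardy hf.periodicC1 h0 (k := -((0 : ℕ) : ℤ)) (by simp) (by omega)
    have hS := hardy_constSum_nonneg (d := d) (k := -((0 : ℕ) : ℤ)) (by omega)
    have hT := three_le_mul_hardyRellich_constSum (d := d) (k := -((0 : ℕ) : ℤ)) (by simp)
    have h2 : weightedIntegral (-((0 : ℕ) : ℤ)) (gradSq f) ≤
        weightedIntegral (-((0 : ℕ) : ℤ)) (fun x => ‖lap f x‖ ^ 2) := by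
      simpa using weightedIntegral_zero_gradSq_le hf h0 (by omega)
    refine h1.trans ((mul_le_mul_of_nonneg_left h2 hS).trans ?_)
    refine mul_le_mul_of_nonneg_right ?_ (hL _)
    -- At `k = 0`, Hardy and the unweighted gradient bound give the constant `S` alone; the bound
    -- `3` on the Hardy-Rellich factor beats the `1/2`.
    have aux : ∀ T S : ℝ, 3 ≤ T → 0 ≤ S → S ≤ 1 / 2 * (T * S) := fun T S h3 h0 => by nlinarith
    exact aux _ _ hT hS
  | succ n ih =>
    have e : -((n + 1 : ℕ) : ℤ) + 1 = -(n : ℤ) := by push_cast; ring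
    have ih' := ih (by push_cast at h; omega)
    rw [← e, add_sub_cancel_right] at ih'
    set k : ℤ := -((n + 1 : ℕ) : ℤ)
    have hk : k < 0 := by omega
    -- At `k + 1` the leading term of the Rellich step is the quantity wanted at `k`, and its
    -- remainder is the quantity bounded by the induction hypothesis.
    have hs := rellich_step hf (k := k + 1) (by omega) (by omega)
    rw [show k + 1 - 2 = k - 1 by ring, add_sub_cancel_right] at hs
    have h1 := weightedIntegral_succ_le (p := k) (by omega)
      hf.laplacianWithin.periodicC1.continuousOn_normSq fun x => sq_nonneg _
    have hM := rellichM_pos (d := d) (k := k + 1) (by omega) (by omega)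
    have hE := rellichE_nonneg (d := d) (k := k + 1) (by omega) (by omega)
    have hS := hardy_constSum_nonneg (d := d) (k := k + 1) (by omega)
    have hT := three_le_mul_hardyRellich_constSum (d := d) (k := k + 1) (by omega)
    have hc := mul_le_mul_of_nonneg_right (rellich_const_step (d := d) hk h) (hL k)
    set TS := (d * constSum hardyRellichC1 hardyRellichC2 (k + 1) d *
      constSum hardyC1 hardyC2 (k + 1) d)
    have hTS : 0 ≤ TS := mul_nonneg (by linarith) hS
    set M := rellichM (k + 1) d
    set E := rellichE (k + 1) d
    have h2 : weightedIntegral (k + 1) (fun x => ‖lap f x‖ ^ 2) +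
        2 * M * E * weightedIntegral k (fun x => ‖f x‖ ^ 2) ≤
        d * (1 + M * E * TS) * weightedIntegral k (fun x => ‖lap f x‖ ^ 2) := by
      have h3 := mul_le_mul_of_nonneg_left ih' (by positivity : 0 ≤ 2 * M * E)
      have h4 := mul_le_mul_of_nonneg_left h1 (by positivity : 0 ≤ 1 + M * E * TS)
      calc _ ≤ (1 + M * E * TS) * weightedIntegral (k + 1) (fun x => ‖lap f x‖ ^ 2) := by linarith
        _ ≤ _ := h4
        _ = _ := by ring
    refine le_of_mul_le_mul_left ((hs.trans h2).trans (hc.trans (le_of_eq ?_)))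
      (by positivity : 0 < M ^ 2)
    ring

/-- The left side is what the argument produces. The right side exceeds it because `rellichM *
rellichE ≤ rellichC2` and the `rellichC1` term is nonnegative. -/
lemma le_R_denom (hk : k ≤ 0) (h : 0 < (d : ℤ) + 2 * k - 4) :
    1 + rellichM k d * rellichE k d *
      (d * constSum hardyRellichC1 hardyRellichC2 k d * constSum hardyC1 hardyC2 k d) ≤
    1 + (HR k d)⁻¹ * (d * rellichC1 ((k : ℝ) / 2) d +
      d * rellichC2 ((k : ℝ) / 2) d * (H k d)⁻¹) := by
  unfold HR H
  rw [inv_inv, inv_inv]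
  have h1 := rellichC1_nonneg (d := d) hk h
  have h2 := rellichM_mul_rellichE_le (d := d) hk h
  have hS := hardy_constSum_nonneg (d := d) (k := k) (by omega)
  have hT := three_le_mul_hardyRellich_constSum (d := d) (k := k) hk
  set T := constSum hardyRellichC1 hardyRellichC2 k d
  set S := constSum hardyC1 hardyC2 k d
  have h3 := mul_le_mul_of_nonneg_right h2 (mul_nonneg (by linarith : 0 ≤ d * T) hS)
  have h4 := mul_nonneg (by linarith : 0 ≤ d * T) h1
  linarith

lemma R_nonneg (hk : k ≤ 0) (h : 0 < (d : ℤ) + 2 * k - 4) : 0 ≤ R k d := by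
  have h1 := le_R_denom (d := d) hk h
  have hM := rellichM_pos (d := d) hk h
  have hE := rellichE_nonneg (d := d) hk h
  have hS := hardy_constSum_nonneg (d := d) (k := k) (by omega)
  have hT := three_le_mul_hardyRellich_constSum (d := d) (k := k) hk
  have h2 := mul_nonneg (mul_nonneg hM.le hE) (mul_nonneg (zero_le_three.trans hT) hS)
  unfold R
  exact div_nonneg (by positivity) (by linarith)

/-- The weighted Rellich inequality. -/
theorem weighted_rellich (hf : SmoothPeriodic f) (h0 : ∫ x in cube d, f x = 0)
    (hk : k ≤ 0) (h : 0 < (d : ℤ) + 2 * k - 4) :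
    R k d * weightedIntegral (k - 2) (fun x => ‖f x‖ ^ 2) ≤
      weightedIntegral k (fun x => ‖lap f x‖ ^ 2) := by
  have h1 := le_R_denom (d := d) hk h
  have hM := rellichM_pos (d := d) hk h
  have hE := rellichE_nonneg (d := d) hk h
  have hS := hardy_constSum_nonneg (d := d) (k := k) (by omega)
  have hT := three_le_mul_hardyRellich_constSum (d := d) (k := k) hk
  have h2 := mul_nonneg (mul_nonneg hM.le hE) (mul_nonneg (zero_le_three.trans hT) hS)
  have hs := rellich_step hf hk h
  have hl := weightedIntegral_lower_order_le hf h0 hk h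
  have hL : 0 ≤ weightedIntegral k (fun x => ‖lap f x‖ ^ 2) :=
    weightedIntegral_nonneg k fun x => sq_nonneg _
  have hR : R k d = rellichM k d ^ 2 / (1 + (HR k d)⁻¹ * (d * rellichC1 ((k : ℝ) / 2) d +
      d * rellichC2 ((k : ℝ) / 2) d * (H k d)⁻¹)) := by
    unfold R rellichM
    rw [← div_div]
    congr 1
    ring
  rw [hR, div_mul_eq_mul_div, div_le_iff₀ (by linarith)]
  have h3 := mul_le_mul_of_nonneg_left hl
    (by positivity : 0 ≤ 2 * rellichM k d * rellichE k d)
  have h4 := mul_le_mul_of_nonneg_left h1 hL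
  linarith

/-- Iterated weighted Rellich inequality. -/
theorem weighted_rellich_iterate (hf : SmoothPeriodic f) (h0 : ∫ x in cube d, f x = 0) (m : ℕ)
    (hk : k ≤ 0) (h : 0 < (d : ℤ) + 2 * k - 4 * m) :
    (∏ i ∈ Finset.range m, R (k - 2 * i) d) * weightedIntegral (k - 2 * m) (fun x => ‖f x‖ ^ 2) ≤
      weightedIntegral k (fun x => ‖iterLaplacian m f x‖ ^ 2) := by
  induction m generalizing k with
  | zero => simp [iterLaplacian]
  | succ m ih =>
    push_cast at h
    have h1 := weighted_rellich (hf.iterLaplacian m) (hf.integral_iterLaplacian h0 m) hk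
      (by omega)
    -- The outermost Laplacian uses weight `k` and constant `R k d`, the `i = 0` factor; the
    -- remaining `m` start from weight `k - 2`.
    have h2 := ih (k := k - 2) (by omega) (by omega)
    have h3 := mul_le_mul_of_nonneg_left h2 (R_nonneg (d := d) hk (by omega))
    rw [Finset.prod_range_succ', iterLaplacian_succ]
    refine le_trans (le_of_eq ?_) (h3.trans h1)
    have e1 : k - 2 * ((m + 1 : ℕ) : ℤ) = k - 2 - 2 * m := by push_cast; ring
    have e2 : ∀ i : ℕ, k - 2 * ((i + 1 : ℕ) : ℤ) = k - 2 - 2 * i := by intro i; push_cast; ring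
    rw [e1]
    simp only [e2, Nat.cast_zero, mul_zero, sub_zero]
    ring

end

end TorusHardy

theorem theorem3p11 (d m : ℕ) (k : ℤ) (hk : k ≤ 0)
    (ψ : EuclideanSpace ℝ (Fin d) → ℂ) (hψ : TorusHardy.SmoothPeriodic ψ)
    (havg : ∫ x in TorusHardy.cube d, ψ x = 0) :
    ((d : ℤ) > -2 * k + 4 * m →
      IntegrableOn (fun x => ‖ψ x‖ ^ 2 * TorusHardy.omega x ^ (k - 2 * m))
        (TorusHardy.cube d) ∧
      IntegrableOn (fun x => ‖TorusHardy.iterLaplacian m ψ x‖ ^ 2 * TorusHardy.omega x ^ k)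
        (TorusHardy.cube d) ∧
      (∏ i ∈ Finset.range m, TorusHardy.R (k - 2 * i) d) *
          ∫ x in TorusHardy.cube d, ‖ψ x‖ ^ 2 * TorusHardy.omega x ^ (k - 2 * m) ≤
        ∫ x in TorusHardy.cube d,
          ‖TorusHardy.iterLaplacian m ψ x‖ ^ 2 * TorusHardy.omega x ^ k) ∧
    ((d : ℤ) > -2 * k + 4 * m + 2 →
      IntegrableOn (fun x => ‖ψ x‖ ^ 2 * TorusHardy.omega x ^ (k - (2 * m + 1)))
        (TorusHardy.cube d) ∧
      IntegrableOn
        (fun x => TorusHardy.gradSq (TorusHardy.iterLaplacian m ψ) x * TorusHardy.omega x ^ k)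
        (TorusHardy.cube d) ∧
      (TorusHardy.H k d * ∏ i ∈ Finset.range m, TorusHardy.R (k - 2 * i - 1) d) *
          ∫ x in TorusHardy.cube d, ‖ψ x‖ ^ 2 * TorusHardy.omega x ^ (k - (2 * m + 1)) ≤
        ∫ x in TorusHardy.cube d,
          TorusHardy.gradSq (TorusHardy.iterLaplacian m ψ) x * TorusHardy.omega x ^ k) := by
  have hmψ := (hψ.iterLaplacian m).periodicC1
  have hc := hψ.periodicC1.continuousOn_normSq
  refine ⟨fun h => ?_, fun h => ?_⟩
  · have : NeZero d := ⟨by omega⟩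
    exact ⟨TorusHardy.integrableOn_mul_omega_zpow (by omega) hc,
      TorusHardy.integrableOn_mul_omega_zpow (by omega) hmψ.continuousOn_normSq,
      TorusHardy.weighted_rellich_iterate hψ havg m hk (by omega)⟩
  · have : NeZero d := ⟨by omega⟩
    refine ⟨TorusHardy.integrableOn_mul_omega_zpow (by omega) hc,
      TorusHardy.integrableOn_mul_omega_zpow (by omega) hmψ.continuousOn_gradSq, ?_⟩
    -- Hardy applied to `Δ^m ψ` lowers the exponent from `k` to `k - 1`, where the iterated Rellich
    -- inequality takes over.
    have h1 := TorusHardy.weighted_rellich_iterate hψ havg m (k := k - 1) (by omega) (by omega)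
    have h2 := TorusHardy.weighted_hardy hmψ (hψ.integral_iterLaplacian havg m) hk (by omega)
    have hS := TorusHardy.hardy_constSum_pos (d := d) hk (by omega)
    have h3 := h1.trans h2
    have e1 : k - 1 - 2 * (m : ℤ) = k - (2 * m + 1) := by ring
    have e2 : ∀ i : ℕ, k - 1 - 2 * (i : ℤ) = k - 2 * i - 1 := by intro i; ring
    simp only [e1, e2] at h3
    unfold TorusHardy.H
    rw [mul_assoc, inv_mul_le_iff₀ hS]
    exact h3
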